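/- Let $f:\mathbb R^n\to\mathbb R$ ($n\ge 1$) be convex and differentiable with a minimizer $x_*$. Suppose that $|\nabla_i f(x+ue_i)-\nabla_i f(x)|\le L_i|u|$ for all $x\in\mathbb R^n$, $u\in\mathbb R$, $1\le i\le n$, that $\nabla f$ is $L$-Lipschitz for the Euclidean norm, and that $\overline L=\frac1n\sum_{i=1}^n L_i>0$. Let $x_0\in\mathbb R^n$, $R=\|x_0-x_*\|_2>0$, $H=\overline L$, $Z=\sum_{i=1}^n(H+L_i)$, $\lambda=\frac1{2H}$. *The method (with numbers of iterations $\widetilde N$, $N_\delta$).* Set $A_0=0$, $v_0=x_0$. For $k=0,\dots,\widetilde N-1$ put $$a_{k+1}=\tfrac12\Big(\lambda+\sqrt{\lambda^2+4\lambda A_k}\Big),\qquad A_{k+1}=A_k+a_{k+1},\qquad \widetilde x_k=\frac{A_kv_k+a_{k+1}x_k}{A_{k+1}};$$ let $v_{k+1}$ be the result of $N_\delta$ steps of coordinate descent for $F(y)=f(y)+\frac H2\|y-\widetilde x_k\|_2^2$ started at $y=\widetilde x_k$, each of which draws, independently of the past, an index $i$ with probability $p_i=(H+L_i)/Z$ and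 replaces $y_i$ by $y_i-\frac1{H+L_i}\nabla_iF(y)$; then put $x_{k+1}=x_k-a_{k+1}\nabla f(v_{k+1})$. The output is $v_{\widetilde N}$. The numbers of iterations are, for accuracy $\varepsilon>0$ and failure probability $\delta\in(0,1)$, $$\widetilde N=\left\lceil\frac{4\sqrt{15}}5\sqrt{\frac{HR^2}{\varepsilon}}\right\rceil,\qquad N_\delta=\left\lceil\frac ZH\ln\left\{\frac{\widetilde N}{\delta}\Big(1+\frac LH\Big)\Big(3+\frac{2L}H\Big)^2\right\}\right\rceil .$$ *Cost model.* The method is run as a program on a real random-access machine: literals, reads, writes, arithmetic operations, square roots and loop steps cost one unit each; the distribution $(p_i)$ is computed and prepared for sampling once, the preparation costing $n+1$ units, after which each draw from it costs one unit; the gradient $\nabla f(v_{k+1})$ is computed component by component; the computation of one component $\nabla_if(y)$ costs at most $cs$ units for every $y$ and $i$ (plus one unit for the call), where $s\ge1$. *Claim.* For every $c>0$ there is a constant $C>0$ depending only on $c$, and for all $L\ge 0$, $\overline L>0$, $R>0$ there is a $\theta>0$ depending only on $L,\overline L,R$, such that for all $n,f,L_1,\dots,L_n,x_0,x_*,s$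 as above and all $\varepsilon\in(0,\overline LR^2]$, $\delta\in(0,1)$ with $\varepsilon^{1/2}\delta\le\theta$, the output satisfies $$\Pr\big(f(v_{\widetilde N})-f(x_*)<\varepsilon\big)\ge1-\delta,$$ and the total algorithmic cost $T$ of the method satisfies, for every outcome of the random draws, $$T\le C\cdot sn\sqrt{\frac{\overline L\,\|x_0-x_*\|_2^2}{\varepsilon}}\;\log\left\{\frac1{\varepsilon^{1/2}\delta}\right\}.$$ -/

import Mathlib

open scoped Gradient

noncomputable section

namespace CatalystCD

/-! ### A randomized real random-access machine with unit-cost primitives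

The machine works on real scalars, real arrays of length `n`, array indices and loop counters.
Every arithmetic operation, read, write and loop step costs one unit.  It has access to a
subroutine computing one component of a gradient, whose cost is charged to the caller, and it can
draw from a finite distribution in unit time after a linear-time preparation. -/

/-- Real scalar registers. -/
inductive Scalar
  | H | lam | A | Anext | a | Z | g
  deriving DecidableEq

/-- Arrays of `n` reals. -/
inductive Arr
  | x | v | y | xt | lip | p
  deriving DecidableEq

/-- Index registers. -/
inductive Idx
  | i | j
  deriving DecidableEq

/-- Read-only loop counters. -/
inductive Cnt
  | outer | inner
  deriving DecidableEq

/-- Scalar expressions. -/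
inductive Expr
  | lit (k : ℕ)
  | var (r : Scalar)
  | get (b : Arr) (k : Idx)
  | add (e e' : Expr)
  | sub (e e' : Expr)
  | mul (e e' : Expr)
  | div (e e' : Expr)
  | sqrt (e : Expr)

/-- Commands. -/
inductive Cmd
  /-- `r := e` -/
  | assign (r : Scalar) (e : Expr)
  /-- `b[k] := e` -/
  | store (b : Arr) (k : Idx) (e : Expr)
  /-- `r := ∇ₖ f (b)`, by a call of the gradient component subroutine -/
  | call (r : Scalar) (b : Arr) (k : Idx)
  /-- prepare the sampler for the distribution whose probabilities are stored in `b` -/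
  | prepare (b : Arr)
  /-- draw the index `k` from the prepared distribution -/
  | draw (k : Idx)
  /-- sequential composition -/
  | seq (c c' : Cmd)
  /-- repeat `c` as often as the counter says -/
  | loop (t : Cnt) (c : Cmd)
  /-- run `c` once for each value `0, …, n - 1` of the index register `k`, in this order -/
  | forAll (k : Idx) (c : Cmd)

/-- The contents of the memory. -/
structure Mem (n : ℕ) where
  sc : Scalar → ℝ
  arr : Arr → Fin n → ℝ
  idx : Idx → Fin n
  cnt : Cnt → ℕ
  smp : PMF (Fin n)

/-- The gradient component subroutine: its value and its cost at each point, for each index. -/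
structure Oracle (n : ℕ) where
  val : (Fin n → ℝ) → Fin n → ℝ
  cost : (Fin n → ℝ) → Fin n → ℕ

variable {n : ℕ}

/-- The value of an expression. -/
def Expr.eval (m : Mem n) : Expr → ℝ
  | .lit k => k
  | .var r => m.sc r
  | .get b k => m.arr b (m.idx k)
  | .add e e' => e.eval m + e'.eval m
  | .sub e e' => e.eval m - e'.eval m
  | .mul e e' => e.eval m * e'.eval m
  | .div e e' => e.eval m / e'.eval m
  | .sqrt e => √(e.eval m)

/-- The cost of evaluating an expression: one unit for each literal, read and operation. -/
def Expr.cost : Expr → ℕ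
  | .lit _ => 1
  | .var _ => 1
  | .get _ _ => 1
  | .add e e' => e.cost + e'.cost + 1
  | .sub e e' => e.cost + e'.cost + 1
  | .mul e e' => e.cost + e'.cost + 1
  | .div e e' => e.cost + e'.cost + 1
  | .sqrt e => e.cost + 1

/-- The distribution on indices proportional to the nonnegative weights `w` (a point mass if they
are all zero). -/
def lawOf [NeZero n] (w : Fin n → ℝ) : PMF (Fin n) :=
  if h : ∑' k, ENNReal.ofReal (w k) ≠ 0 then
    PMF.normalize (fun k => ENNReal.ofReal (w k)) h
      (by rw [tsum_fintype]; exact ENNReal.sum_ne_top.2 fun _ _ => ENNReal.ofReal_ne_top)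
  else PMF.pure 0

/-- Continue the run `P` (final memory and cost so far) with `q`, adding the costs. -/
def andThen (P : PMF (Mem n × ℕ)) (q : Mem n → PMF (Mem n × ℕ)) : PMF (Mem n × ℕ) :=
  P.bind fun r => (q r.1).map fun r' => (r'.1, r.2 + r'.2)

/-- `k` repetitions of `q`, with one unit of overhead for each. -/
def iter (q : Mem n → PMF (Mem n × ℕ)) : ℕ → Mem n → PMF (Mem n × ℕ)
  | 0, m => PMF.pure (m, 0)
  | k + 1, m => andThen (PMF.pure (m, 1)) fun m' => andThen (q m') (iter q k)

/-- One run of `q` for each index in the list `l`, written to the register `k`, with one unit of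
overhead for each. -/
def iterList (q : Mem n → PMF (Mem n × ℕ)) (k : Idx) : List (Fin n) → Mem n → PMF (Mem n × ℕ)
  | [], m => PMF.pure (m, 0)
  | t :: l, m =>
    andThen (PMF.pure ({ m with idx := Function.update m.idx k t }, 1))
      fun m' => andThen (q m') (iterList q k l)

/-- The joint law of the final memory and of the number of steps of a command. -/
def Cmd.exec [NeZero n] (O : Oracle n) : Cmd → Mem n → PMF (Mem n × ℕ)
  | .assign r e, m =>
    PMF.pure ({ m with sc := Function.update m.sc r (e.eval m) }, e.cost + 1)
  | .store b k e, m =>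
    PMF.pure
      ({ m with
          arr := Function.update m.arr b (Function.update (m.arr b) (m.idx k) (e.eval m)) },
        e.cost + 1)
  | .call r b k, m =>
    PMF.pure ({ m with sc := Function.update m.sc r (O.val (m.arr b) (m.idx k)) },
      O.cost (m.arr b) (m.idx k) + 1)
  | .prepare b, m => PMF.pure ({ m with smp := lawOf (m.arr b) }, n + 1)
  | .draw k, m => m.smp.map fun t => ({ m with idx := Function.update m.idx k t }, 1)
  | .seq c c', m => andThen (c.exec O m) (c'.exec O)
  | .loop t c, m => iter (c.exec O) (m.cnt t) m
  | .forAll k c, m => iterList (c.exec O) k (List.finRange n) m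

/-! ### The method -/

/-- Execution of a list of commands one after the other. -/
def block : Cmd → List Cmd → Cmd
  | c, [] => c
  | c, c' :: l => .seq c (block c' l)

/-- `H + Lₖ` -/
def smoothness (k : Idx) : Expr := .add (.var .H) (.get .lip k)

/-- `λ := 1 / (2H)`, `A := 0`, `v := x`, and, once and for all, `Z := ∑ (H + Lⱼ)`,
`pⱼ := (H + Lⱼ) / Z` and the sampler for `p`. -/
def setup : Cmd :=
  block (.assign .lam (.div (.lit 1) (.mul (.lit 2) (.var .H))))
    [.assign .A (.lit 0),
     .forAll .j (.store .v .j (.get .x .j)),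
     .assign .Z (.lit 0),
     .forAll .j (.assign .Z (.add (.var .Z) (smoothness .j))),
     .forAll .j (.store .p .j (.div (smoothness .j) (.var .Z))),
     .prepare .p]

/-- One step of coordinate descent for `F(y) = f(y) + (H/2) ‖y - x̃‖²`, in place:
`i ∼ p`, `yᵢ := yᵢ - (1 / (H + Lᵢ)) (∇ᵢ f(y) + H (yᵢ - x̃ᵢ))`. -/
def innerStep : Cmd :=
  block (.draw .i)
    [.call .g .y .i,
     .store .y .i (.sub (.get .y .i) (.mul (.div (.lit 1) (smoothness .i))
       (.add (.var .g) (.mul (.var .H) (.sub (.get .y .i) (.get .xt .i))))))]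

/-- One outer step: `a := (λ + √(λ² + 4λA)) / 2`, `A⁺ := A + a`, `x̃ := (A v + a x) / A⁺`, then
coordinate descent started at `y = x̃`, `v := y`, and `x := x - a ∇f(v)`, the gradient being
computed component by component. -/
def outerStep : Cmd :=
  block (.assign .a (.div (.add (.var .lam) (.sqrt (.add (.mul (.var .lam) (.var .lam))
      (.mul (.lit 4) (.mul (.var .lam) (.var .A)))))) (.lit 2)))
    [.assign .Anext (.add (.var .A) (.var .a)),
     .forAll .j (.store .xt .j (.div (.add (.mul (.var .A) (.get .v .j))
       (.mul (.var .a) (.get .x .j))) (.var .Anext))),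
     .assign .A (.var .Anext),
     .forAll .j (.store .y .j (.get .xt .j)),
     .loop .inner innerStep,
     .forAll .j (.store .v .j (.get .y .j)),
     .forAll .j (.seq (.call .g .v .j)
       (.store .x .j (.sub (.get .x .j) (.mul (.var .a) (.var .g)))))]

/-- The whole method; its output is the array `v`. -/
def method : Cmd := .seq setup (.loop .outer outerStep)

/-- The initial memory: the inputs `H`, `x₀`, `L₁, …, Lₙ` and the two numbers of iterations; all
the rest is blank. -/
def input [NeZero n] (H : ℝ) (x₀ lip : Fin n → ℝ) (outer inner : ℕ) : Mem n where
  sc := Function.update (fun _ => 0) Scalar.H H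
  arr := Function.update (Function.update (fun _ _ => 0) Arr.x x₀) Arr.lip lip
  idx := fun _ => 0
  cnt := fun t => match t with
    | .outer => outer
    | .inner => inner
  smp := PMF.pure 0

/-- The gradient component subroutine for `f`, with the cost function `τ`. -/
def gradOracle (f : EuclideanSpace ℝ (Fin n) → ℝ) (τ : EuclideanSpace ℝ (Fin n) → Fin n → ℕ) :
    Oracle n where
  val b k := (∇ f (WithLp.toLp 2 b)) k
  cost b k := τ (WithLp.toLp 2 b) k

/-- The law of (output point, total number of steps) of the method. -/
def run [NeZero n] (f : EuclideanSpace ℝ (Fin n) → ℝ) (τ : EuclideanSpace ℝ (Fin n) → Fin n → ℕ)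
    (H : ℝ) (x₀ : EuclideanSpace ℝ (Fin n)) (lip : Fin n → ℝ) (outer inner : ℕ) :
    PMF (EuclideanSpace ℝ (Fin n) × ℕ) :=
  (method.exec (gradOracle f τ) (input H x₀.ofLp lip outer inner)).map
    fun r => (WithLp.toLp 2 (r.1.arr .v), r.2)

/-- The number of outer iterations `⌈(4√15 / 5) √(H R² / ε)⌉`. -/
def outerCount (H R ε : ℝ) : ℕ := ⌈4 * √15 / 5 * √(H * R ^ 2 / ε)⌉₊

/-- The number of inner iterations `⌈(Z / H) ln ((N / δ) (1 + L/H) (3 + 2L/H)²)⌉` for `N` outer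
iterations, where `Z = ∑ (H + Lᵢ)`. -/
def innerCount (H L : ℝ) (lip : Fin n → ℝ) (N : ℕ) (δ : ℝ) : ℕ :=
  ⌈(∑ i, (H + lip i)) / H * Real.log (N / δ * (1 + L / H) * (3 + 2 * L / H) ^ 2)⌉₊

end CatalystCD

end

/-! The outer method is an accelerated proximal scheme. It keeps the energy `A (f v - f x*) + ‖x -
x*‖² / 2` from increasing as long as each inner loop returns a point `v` with `‖∇F v‖ ≤ (H/2) ‖v -
z‖`, where `z` is the prox centre (`energy_step`). The step sizes force `A ≥ k² / (8H)` after `k`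
steps (`stepSize_growth`), so after `outerCount` steps the energy bound makes `f v - f x*` smaller
than `ε` (`Inv.sub_lt`).

The inner objective `F` is `H`-strongly convex. Sampling coordinate `i` with probability
proportional to `H + Lᵢ` contracts the expected gap `F - min F` by `1 - H/Z` per step
(`expect_coordStep_le`). The criterion holds once the gap has fallen by the factor `κ = (1 + L/H)(3
+ 2L/H)²` (`norm_proxGrad_le`). After `innerCount` steps Markov's inequality bounds the failure
probability of one inner loop by `δ/N`, and a union bound over the `N` loops gives `δ`
(`wp_method_le`).

The program is linked to this analysis by expectations and sure postconditions of commands. Its cost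
is bounded from the syntax alone, for every outcome: since `Z/H = 2n`, there are `O(n log)` inner
steps per outer step. -/

namespace CatalystCD

open scoped InnerProductSpace ENNReal

/-! ### Expectations under discrete laws, Markov's inequality -/

section Expectation

variable {α β : Type*}

/-- The expectation of a nonnegative function under a probability mass function. -/
noncomputable def expect (p : PMF α) (φ : α → ℝ≥0∞) : ℝ≥0∞ := ∑' a, p a * φ a

theorem expect_pure (a : α) (φ : α → ℝ≥0∞) : expect (PMF.pure a) φ = φ a := by
  unfold expect
  rw [tsum_eq_single a]
  · simp
  · intro b hb
    simp [PMF.pure_apply, hb]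

theorem expect_bind (p : PMF α) (q : α → PMF β) (φ : β → ℝ≥0∞) :
    expect (p.bind q) φ = expect p fun a => expect (q a) φ := by
  simp only [expect, PMF.bind_apply, ← ENNReal.tsum_mul_right, ← ENNReal.tsum_mul_left]
  rw [ENNReal.tsum_comm]
  simp only [mul_assoc]

theorem expect_map (p : PMF α) (g : α → β) (φ : β → ℝ≥0∞) :
    expect (p.map g) φ = expect p fun a => φ (g a) := by
  rw [PMF.map, expect_bind]
  simp only [Function.comp, expect_pure]

theorem expect_mono (p : PMF α) {φ ψ : α → ℝ≥0∞} (h : ∀ a ∈ p.support, φ a ≤ ψ a) :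
    expect p φ ≤ expect p ψ := by
  refine ENNReal.tsum_le_tsum fun a => ?_
  by_cases ha : a ∈ p.support
  · exact mul_le_mul_right (h a ha) _
  · simp [(PMF.apply_eq_zero_iff p a).2 ha]

theorem expect_const (p : PMF α) (b : ℝ≥0∞) : expect p (fun _ => b) = b := by
  simp [expect, ENNReal.tsum_mul_right]

theorem expect_const_mul (p : PMF α) (b : ℝ≥0∞) (φ : α → ℝ≥0∞) :
    expect p (fun a => b * φ a) = b * expect p φ := by
  simp only [expect, ← ENNReal.tsum_mul_left]
  congr 1
  funext a
  ring

theorem expect_add (p : PMF α) (φ ψ : α → ℝ≥0∞) :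
    expect p (fun a => φ a + ψ a) = expect p φ + expect p ψ := by
  simp only [expect, mul_add, ENNReal.tsum_add]

theorem expect_le (p : PMF α) {φ : α → ℝ≥0∞} {b : ℝ≥0∞} (h : ∀ a ∈ p.support, φ a ≤ b) :
    expect p φ ≤ b :=
  (expect_mono p h).trans (expect_const p b).le

/-- Markov's inequality, in a form that covers a vanishing threshold. -/
theorem expect_indicator_le (p : PMF α) (Q : α → Prop) [DecidablePred Q] {φ : α → ℝ≥0∞}
    {b η : ℝ≥0∞} (hb : b ≠ ⊤) (hφ : expect p φ ≤ η * b) (h : ∀ a ∈ p.support, φ a ≤ b → Q a) :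
    expect p (fun a => if Q a then 0 else 1) ≤ η := by
  -- A zero threshold occurs when descent starts at the minimizer. Then `φ` vanishes on the support,
  -- so `Q` never fails there.
  rcases eq_or_ne b 0 with rfl | hb0
  · rw [mul_zero, nonpos_iff_eq_zero, expect, ENNReal.tsum_eq_zero] at hφ
    have : expect p (fun a => if Q a then (0 : ℝ≥0∞) else 1) ≤ 0 := by
      refine expect_le p fun a ha => ?_
      rw [if_pos]
      refine h a ha ?_
      rcases mul_eq_zero.1 (hφ a) with h' | h'
      · exact absurd h' ha
      · exact h'.le
    exact this.trans zero_le
  · have h1 : b * expect p (fun a => if Q a then (0 : ℝ≥0∞) else 1) ≤ η * b := by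
      rw [← expect_const_mul]
      refine (expect_mono p fun a ha => ?_).trans hφ
      by_cases hQ : Q a
      · simp [hQ]
      · simp only [hQ, if_false, mul_one]
        exact (not_le.1 fun hle => hQ (h a ha hle)).le
    rw [mul_comm] at h1
    exact (ENNReal.mul_le_mul_iff_left hb0 hb).1 h1

/-- Pointwise `1 ≤ 1_S + 1_{¬Q}`; take expectations. -/
theorem one_sub_le_toOuterMeasure (p : PMF α) (S : Set α) (Q : α → Prop) [DecidablePred Q]
    (hQ : ∀ a, Q a → a ∈ S) {η : ℝ≥0∞} (h : expect p (fun a => if Q a then 0 else 1) ≤ η) :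
    1 - η ≤ p.toOuterMeasure S := by
  classical
  rw [tsub_le_iff_right, PMF.toOuterMeasure_apply]
  have h1 : ∑' a, S.indicator p a = expect p (fun a => if a ∈ S then 1 else 0) := by
    simp [expect, Set.indicator]
  rw [h1]
  refine le_trans ?_ (add_le_add_right h _)
  rw [← expect_add]
  refine (expect_const p 1).ge.trans (expect_mono p fun a _ => ?_)
  by_cases hS : a ∈ S
  · simp [hS]
  · have : ¬ Q a := fun h => hS (hQ a h)
    simp [hS, this]

end Expectation

/-! ### Expectations and sure postconditions of programs -/

section Logic

variable {n : ℕ}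

/-- The expectation of a function of the final memory. -/
noncomputable def wp (P : PMF (Mem n × ℕ)) (φ : Mem n → ℝ≥0∞) : ℝ≥0∞ := expect P fun r => φ r.1

/-- Every outcome satisfies the postcondition. -/
def Sat (P : PMF (Mem n × ℕ)) (Q : Mem n → Prop) : Prop := ∀ r ∈ P.support, Q r.1

theorem wp_pure (m : Mem n) (k : ℕ) (φ : Mem n → ℝ≥0∞) : wp (PMF.pure (m, k)) φ = φ m :=
  expect_pure _ _

theorem wp_andThen (P : PMF (Mem n × ℕ)) (q : Mem n → PMF (Mem n × ℕ)) (φ : Mem n → ℝ≥0∞) :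
    wp (andThen P q) φ = wp P fun m => wp (q m) φ := by
  simp only [wp, andThen, expect_bind, expect_map]

theorem mem_support_andThen {P : PMF (Mem n × ℕ)} {q : Mem n → PMF (Mem n × ℕ)}
    {r : Mem n × ℕ} : r ∈ (andThen P q).support ↔
      ∃ r₁ ∈ P.support, ∃ r₂ ∈ (q r₁.1).support, r = (r₂.1, r₁.2 + r₂.2) := by
  simp only [andThen, PMF.mem_support_bind_iff, PMF.mem_support_map_iff, eq_comm]

theorem sat_pure {m : Mem n} {k : ℕ} {Q : Mem n → Prop} (h : Q m) : Sat (PMF.pure (m, k)) Q := by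
  intro r hr
  rw [PMF.mem_support_pure_iff] at hr
  subst hr
  exact h

theorem sat_andThen {P : PMF (Mem n × ℕ)} {q : Mem n → PMF (Mem n × ℕ)} {Q Q' : Mem n → Prop}
    (hP : Sat P Q) (hq : ∀ m, Q m → Sat (q m) Q') : Sat (andThen P q) Q' := by
  intro r hr
  obtain ⟨r₁, h₁, r₂, h₂, rfl⟩ := mem_support_andThen.1 hr
  exact hq _ (hP r₁ h₁) r₂ h₂

theorem wp_le_of_sat {P : PMF (Mem n × ℕ)} {Q : Mem n → Prop} {φ : Mem n → ℝ≥0∞} {b : ℝ≥0∞}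
    (hP : Sat P Q) (h : ∀ m, Q m → φ m ≤ b) : wp P φ ≤ b :=
  expect_le P fun r hr => h _ (hP r hr)

theorem wp_iter_zero (q : Mem n → PMF (Mem n × ℕ)) (m : Mem n) (φ : Mem n → ℝ≥0∞) :
    wp (iter q 0 m) φ = φ m := wp_pure _ _ _

theorem wp_iter_succ (q : Mem n → PMF (Mem n × ℕ)) (k : ℕ) (m : Mem n) (φ : Mem n → ℝ≥0∞) :
    wp (iter q (k + 1) m) φ = wp (q m) fun m' => wp (iter q k m') φ := by
  simp only [iter, wp_andThen, wp_pure]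

/-- Geometric decay by induction. The hypothesis is required at every memory, so a potential meant
for certain memories only must be `⊤` at the others. -/
theorem wp_iter_le (q : Mem n → PMF (Mem n × ℕ)) (φ : Mem n → ℝ≥0∞) (ρ : ℝ≥0∞)
    (h : ∀ m, wp (q m) φ ≤ ρ * φ m) (k : ℕ) (m : Mem n) :
    wp (iter q k m) φ ≤ ρ ^ k * φ m := by
  induction k generalizing m with
  | zero => simp [wp_iter_zero]
  | succ k ih =>
    rw [wp_iter_succ]
    refine (expect_mono _ fun r _ => ih r.1).trans ?_
    rw [expect_const_mul, pow_succ, mul_assoc]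
    exact mul_le_mul_right (h m) _

open Classical in
/-- The probability of leaving an invariant grows at most linearly. -/
theorem wp_iter_not_le (q : Mem n → PMF (Mem n × ℕ)) (I : ℕ → Mem n → Prop) (η : ℝ≥0∞)
    (h : ∀ k m, I k m → wp (q m) (fun m' => if I (k + 1) m' then 0 else 1) ≤ η) (j k : ℕ)
    (m : Mem n) (hm : I k m) :
    wp (iter q j m) (fun m' => if I (k + j) m' then 0 else 1) ≤ j * η := by
  induction j generalizing m k with
  | zero => simp [wp_iter_zero, hm]
  | succ j ih =>
    rw [wp_iter_succ]
    -- Union bound: either the first step already fails, which costs at most `1`, or the induction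
    -- hypothesis applies.
    have hle : ∀ m', wp (iter q j m') (fun m' => if I (k + (j + 1)) m' then 0 else 1) ≤
        (if I (k + 1) m' then 0 else 1) + j * η := by
      intro m'
      by_cases hI : I (k + 1) m'
      · have := ih (k + 1) m' hI
        rw [show k + 1 + j = k + (j + 1) by ring] at this
        simpa [hI] using this
      · simp only [hI, if_false]
        refine le_trans ?_ le_self_add
        refine expect_le _ fun r _ => ?_
        dsimp only
        split_ifs <;> simp
    refine (expect_mono _ fun r _ => hle r.1).trans ?_
    rw [expect_add, expect_const, Nat.cast_succ, add_mul, one_mul, add_comm]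
    exact add_le_add_right (h k m hm) _

/-- The invariant is indexed by the set of indices already visited, which lets it describe a
half-finished pass over an array. `Nodup` guarantees that each index is still unvisited when its
turn comes. -/
theorem sat_iterList (q : Mem n → PMF (Mem n × ℕ)) (k : Idx) (I : (Fin n → Prop) → Mem n → Prop)
    (h : ∀ S t m, ¬ S t → I S m →
      Sat (q { m with idx := Function.update m.idx k t }) (I fun i => S i ∨ i = t))
    (l : List (Fin n)) (hl : l.Nodup) (S : Fin n → Prop) (hS : ∀ t ∈ l, ¬ S t) (m : Mem n)
    (hm : I S m) : Sat (iterList q k l m) (I fun i => S i ∨ i ∈ l) := by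
  induction l generalizing S m with
  | nil => exact sat_pure (by simpa using hm)
  | cons t l ih =>
    rw [List.nodup_cons] at hl
    refine sat_andThen (sat_pure rfl : Sat _ fun m' => m' = _) ?_
    rintro m' rfl
    refine sat_andThen (h S t m (hS t (by simp)) hm) fun m'' hm'' => ?_
    have := ih hl.2 (fun i => S i ∨ i = t) (fun i hi => by
      rintro (h' | rfl)
      · exact hS i (by simp [hi]) h'
      · exact hl.1 hi) m'' hm''
    simpa only [List.mem_cons, or_assoc] using this

/-- The two memories agree except for the scalar registers in `S`, the arrays in `B` and the index
registers. -/
structure Agree (S : Scalar → Prop) (B : Arr → Prop) (m m' : Mem n) : Prop where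
  sc : ∀ r, ¬ S r → m'.sc r = m.sc r
  arr : ∀ b, ¬ B b → m'.arr b = m.arr b
  cnt : m'.cnt = m.cnt
  smp : m'.smp = m.smp

theorem Agree.refl (S : Scalar → Prop) (B : Arr → Prop) (m : Mem n) : Agree S B m m :=
  ⟨fun _ _ => rfl, fun _ _ => rfl, rfl, rfl⟩

variable [NeZero n] (O : Oracle n)

theorem wp_seq (c c' : Cmd) (m : Mem n) (φ : Mem n → ℝ≥0∞) :
    wp ((Cmd.seq c c').exec O m) φ = wp (c.exec O m) fun m' => wp (c'.exec O m') φ :=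
  wp_andThen _ _ _

theorem wp_assign (r : Scalar) (e : Expr) (m : Mem n) (φ : Mem n → ℝ≥0∞) :
    wp ((Cmd.assign r e).exec O m) φ = φ { m with sc := Function.update m.sc r (e.eval m) } :=
  wp_pure _ _ _

theorem sat_seq {c c' : Cmd} {m : Mem n} {Q Q' : Mem n → Prop} (hc : Sat (c.exec O m) Q)
    (hc' : ∀ m', Q m' → Sat (c'.exec O m') Q') : Sat ((Cmd.seq c c').exec O m) Q' :=
  sat_andThen hc hc'

theorem sat_forAll {k : Idx} {c : Cmd} (I : (Fin n → Prop) → Mem n → Prop)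
    (h : ∀ S t m, ¬ S t → I S m →
      Sat (c.exec O { m with idx := Function.update m.idx k t }) (I fun i => S i ∨ i = t))
    {m : Mem n} (hm : I (fun _ => False) m) : Sat ((Cmd.forAll k c).exec O m) (I fun _ => True) := by
  have := sat_iterList (c.exec O) k I h (List.finRange n) (List.nodup_finRange n) _
    (fun _ _ => id) m hm
  simp only [List.mem_finRange, or_true] at this
  exact this

/-- A componentwise computation of an array. -/
theorem sat_forAll_store (b : Arr) (e : Expr) (m : Mem n) (w : Fin n → ℝ)
    (he : ∀ m' t, Agree (fun _ => False) (· = b) m m' → m'.arr b t = m.arr b t → m'.idx .j = t →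
      e.eval m' = w t) :
    Sat ((Cmd.forAll .j (.store b .j e)).exec O m)
      fun m' => Agree (fun _ => False) (· = b) m m' ∧ m'.arr b = w := by
  have h := sat_forAll O (k := .j) (c := .store b .j e) (m := m)
    (fun S m' => Agree (fun _ => False) (· = b) m m' ∧ (∀ i, S i → m'.arr b i = w i) ∧
      ∀ i, ¬ S i → m'.arr b i = m.arr b i) ?_
    ⟨Agree.refl _ _ _, fun _ h => h.elim, fun _ _ => rfl⟩
  · intro r hr
    obtain ⟨h1, h2, -⟩ := h r hr
    exact ⟨h1, funext fun i => h2 i trivial⟩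
  · rintro S t m' ht ⟨h1, h2, h3⟩
    have hv := he { m' with idx := Function.update m'.idx .j t } t ⟨h1.sc, h1.arr, h1.cnt, h1.smp⟩
      (h3 t ht) (by simp)
    refine sat_pure ⟨⟨h1.sc, fun b' hb' => ?_, h1.cnt, h1.smp⟩, fun i hi => ?_, fun i hi => ?_⟩
    · simpa [Function.update_of_ne hb'] using h1.arr b' hb'
    · by_cases hit : i = t
      · subst hit
        simp [hv]
      · simpa [hit] using h2 i (by tauto)
    · have hit : i ≠ t := fun h => hi (Or.inr h)
      simpa [hit] using h3 i fun h => hi (Or.inl h)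

end Logic

/-! ### Worst-case cost from the syntax -/

section Cost

variable {n : ℕ}

/-- A bound on the number of steps of a command, when each call of the subroutine costs at most
`K`. -/
def Cmd.bound (n : ℕ) (K : ℝ) (t : Cnt → ℕ) : Cmd → ℝ
  | .assign _ e => e.cost + 1
  | .store _ _ e => e.cost + 1
  | .call _ _ _ => K + 1
  | .prepare _ => n + 1
  | .draw _ => 1
  | .seq c c' => c.bound n K t + c'.bound n K t
  | .loop u c => t u * (c.bound n K t + 1)
  | .forAll _ c => n * (c.bound n K t + 1)

theorem iter_cost_le (q : Mem n → PMF (Mem n × ℕ)) (t : Cnt → ℕ) (B : ℝ)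
    (h : ∀ m, m.cnt = t → ∀ r ∈ (q m).support, r.1.cnt = t ∧ (r.2 : ℝ) ≤ B) (k : ℕ) (m : Mem n)
    (hm : m.cnt = t) : ∀ r ∈ (iter q k m).support, r.1.cnt = t ∧ (r.2 : ℝ) ≤ k * (B + 1) := by
  induction k generalizing m with
  | zero =>
    intro r hr
    simp only [iter, PMF.mem_support_pure_iff] at hr
    simp [hr, hm]
  | succ k ih =>
    intro r hr
    obtain ⟨r₁, h₁, r₂, h₂, rfl⟩ := mem_support_andThen.1 hr
    rw [PMF.mem_support_pure_iff] at h₁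
    subst h₁
    obtain ⟨r₃, h₃, r₄, h₄, rfl⟩ := mem_support_andThen.1 h₂
    obtain ⟨hc, hb⟩ := h m hm r₃ h₃
    obtain ⟨hc', hb'⟩ := ih r₃.1 hc r₄ h₄
    refine ⟨hc', ?_⟩
    push_cast
    linarith

theorem iterList_cost_le (q : Mem n → PMF (Mem n × ℕ)) (k : Idx) (t : Cnt → ℕ) (B : ℝ)
    (h : ∀ m, m.cnt = t → ∀ r ∈ (q m).support, r.1.cnt = t ∧ (r.2 : ℝ) ≤ B) (l : List (Fin n))
    (m : Mem n) (hm : m.cnt = t) :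
    ∀ r ∈ (iterList q k l m).support, r.1.cnt = t ∧ (r.2 : ℝ) ≤ l.length * (B + 1) := by
  induction l generalizing m with
  | nil =>
    intro r hr
    simp only [iterList, PMF.mem_support_pure_iff] at hr
    simp [hr, hm]
  | cons a l ih =>
    intro r hr
    obtain ⟨r₁, h₁, r₂, h₂, rfl⟩ := mem_support_andThen.1 hr
    rw [PMF.mem_support_pure_iff] at h₁
    subst h₁
    obtain ⟨r₃, h₃, r₄, h₄, rfl⟩ := mem_support_andThen.1 h₂
    obtain ⟨hc, hb⟩ := h { m with idx := Function.update m.idx k a } hm r₃ h₃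
    obtain ⟨hc', hb'⟩ := ih r₃.1 hc r₄ h₄
    refine ⟨hc', ?_⟩
    push_cast [List.length_cons]
    linarith

/-- No command writes a loop counter, so the number of repetitions is known in advance and the bound
does not depend on the draws. Preservation of `cnt` is carried through the induction. -/
theorem exec_cost_le [NeZero n] (O : Oracle n) (K : ℝ) (hK : ∀ y i, (O.cost y i : ℝ) ≤ K)
    (t : Cnt → ℕ) (c : Cmd) (m : Mem n) (hm : m.cnt = t) :
    ∀ r ∈ (c.exec O m).support, r.1.cnt = t ∧ (r.2 : ℝ) ≤ c.bound n K t := by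
  induction c generalizing m with
  | assign r e | store b k e | prepare b =>
    intro r hr
    rw [Cmd.exec, PMF.mem_support_pure_iff] at hr
    simp [hr, hm, Cmd.bound]
  | call r b k =>
    intro r hr
    rw [Cmd.exec, PMF.mem_support_pure_iff] at hr
    simp [hr, hm, Cmd.bound, hK]
  | draw k =>
    intro r hr
    rw [Cmd.exec, PMF.mem_support_map_iff] at hr
    obtain ⟨i, -, rfl⟩ := hr
    simp [hm, Cmd.bound]
  | seq c c' ih ih' =>
    intro r hr
    obtain ⟨r₁, h₁, r₂, h₂, rfl⟩ := mem_support_andThen.1 hr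
    obtain ⟨hc, hb⟩ := ih m hm r₁ h₁
    obtain ⟨hc', hb'⟩ := ih' r₁.1 hc r₂ h₂
    refine ⟨hc', ?_⟩
    simp only [Cmd.bound]
    push_cast
    linarith
  | loop u c ih =>
    have := iter_cost_le (c.exec O) t _ ih (t u) m hm
    subst hm
    exact this
  | forAll k c ih =>
    have := iterList_cost_le (c.exec O) k t _ ih (List.finRange n) m hm
    rw [List.length_finRange] at this
    exact this

end Cost

/-! ### Convex analysis of the proximal objective and the energy -/

section Analysis

variable {E : Type*} [NormedAddCommGroup E] [InnerProductSpace ℝ E]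

theorem norm_add_sub_sq (x d z : E) :
    ‖x + d - z‖ ^ 2 = ‖x - z‖ ^ 2 + 2 * ⟪x - z, d⟫_ℝ + ‖d‖ ^ 2 := by
  rw [← norm_add_sq_real]
  congr 2
  abel

/-- The proximal objective `f(y) + (H/2) ‖y - z‖²`. -/
noncomputable def prox (f : E → ℝ) (H : ℝ) (z y : E) : ℝ := f y + H / 2 * ‖y - z‖ ^ 2

/-- `f` is bounded below by `f xstar`, so the quadratic term makes the objective coercive. -/
theorem exists_prox_min [FiniteDimensional ℝ E] {f : E → ℝ} (hf : Continuous f) {H : ℝ}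
    (hH : 0 < H) (z xstar : E) (hmin : ∀ x, f xstar ≤ f x) :
    ∃ w, ∀ y, prox f H z w ≤ prox f H z y := by
  refine Continuous.exists_forall_le (β := E) (f := prox f H z)
    (by unfold prox; fun_prop) ?_
  have h1 : Filter.Tendsto (fun y : E => ‖y - z‖) (Filter.cocompact E) Filter.atTop :=
    (tendsto_norm_cocompact_atTop (E := E)).comp
      (Homeomorph.subRight z).isClosedEmbedding.tendsto_cocompact
  have h2 := Filter.tendsto_atTop_add_const_left _ (f xstar)
    (((Filter.tendsto_pow_atTop two_ne_zero).comp h1).const_mul_atTop (half_pos hH))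
  exact Filter.tendsto_atTop_mono (fun y => by simpa [prox] using hmin y) h2

variable [CompleteSpace E]

theorem hasDerivAt_comp_line {f : E → ℝ} (hf : Differentiable ℝ f) (x d : E) (t : ℝ) :
    HasDerivAt (fun t : ℝ => f (x + t • d)) ⟪∇ f (x + t • d), d⟫_ℝ t := by
  have h1 : HasDerivAt (fun t : ℝ => x + t • d) d t := by
    simpa using ((hasDerivAt_id t).smul_const d).const_add x
  have h2 := (hf (x + t • d)).hasFDerivAt.comp_hasDerivAt t h1
  rwa [← inner_gradient_left] at h2

theorem add_inner_gradient_le {f : E → ℝ} (hf : Differentiable ℝ f)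
    (hconv : ConvexOn ℝ Set.univ f) (x y : E) : f x + ⟪∇ f x, y - x⟫_ℝ ≤ f y := by
  have hc : ConvexOn ℝ Set.univ (fun t : ℝ => f (x + t • (y - x))) := by
    have := hconv.comp_affineMap (AffineMap.lineMap x y : ℝ →ᵃ[ℝ] E)
    have e : f ∘ (AffineMap.lineMap x y : ℝ →ᵃ[ℝ] E) = fun t : ℝ => f (x + t • (y - x)) := by
      funext t
      simp [AffineMap.lineMap_apply, add_comm]
    rwa [e, Set.preimage_univ] at this
  have h := hc.le_slope_of_hasDerivAt (Set.mem_univ 0) (Set.mem_univ 1) zero_lt_one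
    (hasDerivAt_comp_line hf x (y - x) 0)
  simp only [slope_def_field, zero_smul, one_smul, add_zero, add_sub_cancel, sub_zero, div_one] at h
  linarith

/-- The descent lemma along one ray: subtracting the claimed upper model leaves an antitone function
of `t ≥ 0`. Only growth along `d` is assumed, so it serves both the coordinatewise and the full
Lipschitz bound. -/
theorem le_add_inner_gradient {f : E → ℝ} (hf : Differentiable ℝ f) (x d : E) (K : ℝ)
    (h : ∀ t : ℝ, 0 ≤ t → ⟪∇ f (x + t • d), d⟫_ℝ - ⟪∇ f x, d⟫_ℝ ≤ K * t) :
    f (x + d) ≤ f x + ⟪∇ f x, d⟫_ℝ + K / 2 := by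
  have hd : ∀ t : ℝ, HasDerivAt
      (fun t : ℝ => f (x + t • d) - t * ⟪∇ f x, d⟫_ℝ - K / 2 * t ^ 2)
      (⟪∇ f (x + t • d), d⟫_ℝ - ⟪∇ f x, d⟫_ℝ - K * t) t := by
    intro t
    have h1 := ((hasDerivAt_comp_line hf x d t).sub
      ((hasDerivAt_id t).mul_const ⟪∇ f x, d⟫_ℝ)).sub
      (((hasDerivAt_id t).pow 2).const_mul (K / 2))
    refine h1.congr_deriv ?_
    simp only [one_mul, id, Nat.cast_ofNat, Nat.add_one_sub_one, pow_one]
    ring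
  have hanti := antitoneOn_of_deriv_nonpos (convex_Ici (0 : ℝ))
    (fun t _ => (hd t).continuousAt.continuousWithinAt)
    (fun t _ => (hd t).differentiableAt.differentiableWithinAt)
    (fun t ht => by
      rw [(hd t).deriv]
      have := h t (interior_subset ht)
      linarith)
  have := hanti (Set.mem_Ici.2 le_rfl) (Set.mem_Ici.2 zero_le_one) zero_le_one
  simp only [zero_smul, one_smul, add_zero] at this
  linarith

/-- The gradient of `prox f H z`. -/
noncomputable def proxGrad (f : E → ℝ) (H : ℝ) (z y : E) : E := ∇ f y + H • (y - z)

/-- Strong convexity: the quadratic term equals its second-order expansion exactly, and `f` lies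
above its tangent. -/
theorem prox_add_inner_le {f : E → ℝ} (hf : Differentiable ℝ f)
    (hconv : ConvexOn ℝ Set.univ f) (H : ℝ) (z x y : E) :
    prox f H z x + ⟪proxGrad f H z x, y - x⟫_ℝ + H / 2 * ‖y - x‖ ^ 2 ≤ prox f H z y := by
  have h1 := add_inner_gradient_le hf hconv x y
  have h2 := norm_add_sub_sq x (y - x) z
  rw [add_sub_cancel] at h2
  simp only [prox, proxGrad, inner_add_left, inner_smul_left, h2]
  rw [conj_trivial]
  nlinarith

theorem prox_add_le {f : E → ℝ} (hf : Differentiable ℝ f) (H K : ℝ) (z x d : E)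
    (h : ∀ t : ℝ, 0 ≤ t → ⟪∇ f (x + t • d), d⟫_ℝ - ⟪∇ f x, d⟫_ℝ ≤ K * t) :
    prox f H z (x + d) ≤
      prox f H z x + ⟪proxGrad f H z x, d⟫_ℝ + (K + H * ‖d‖ ^ 2) / 2 := by
  have h1 := le_add_inner_gradient hf x d K h
  simp only [prox, proxGrad, inner_add_left, inner_smul_left, norm_add_sub_sq x d z]
  rw [conj_trivial]
  nlinarith

/-- Moving from `w` in the direction of the gradient itself has derivative `‖proxGrad‖²`, which must
vanish at a minimum. -/
theorem proxGrad_eq_zero {f : E → ℝ} (hf : Differentiable ℝ f) (H : ℝ) (z w : E)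
    (hw : ∀ y, prox f H z w ≤ prox f H z y) : proxGrad f H z w = 0 := by
  have h1 : HasDerivAt (fun t : ℝ => prox f H z (w + t • proxGrad f H z w))
      (‖proxGrad f H z w‖ ^ 2) 0 := by
    set g := proxGrad f H z w with hg
    have h2 := hasDerivAt_comp_line hf w g 0
    have h3 : HasDerivAt (fun t : ℝ => H / 2 * ‖w + t • g - z‖ ^ 2) (H * ⟪w - z, g⟫_ℝ) 0 := by
      have : (fun t : ℝ => H / 2 * ‖w + t • g - z‖ ^ 2) =
          fun t : ℝ => H / 2 * (‖w - z‖ ^ 2 + 2 * ⟪w - z, g⟫_ℝ * t + ‖g‖ ^ 2 * t ^ 2) := by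
        funext t
        rw [norm_add_sub_sq, inner_smul_right, norm_smul, mul_pow, Real.norm_eq_abs, sq_abs]
        ring
      rw [this]
      have h4 := ((((hasDerivAt_id (0 : ℝ)).const_mul (2 * ⟪w - z, g⟫_ℝ)).const_add
        (‖w - z‖ ^ 2)).add (((hasDerivAt_id (0 : ℝ)).pow 2).const_mul (‖g‖ ^ 2))).const_mul (H / 2)
      refine h4.congr_deriv ?_
      simp only [id]
      ring
    have h5 := h2.add h3
    refine h5.congr_deriv ?_
    rw [← real_inner_self_eq_norm_sq, zero_smul, add_zero]
    nth_rewrite 3 [hg]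
    rw [proxGrad, inner_add_left, inner_smul_left, conj_trivial]
  have h2 : IsLocalMin (fun t : ℝ => prox f H z (w + t • proxGrad f H z w)) 0 :=
    Filter.Eventually.of_forall fun t => by simpa using hw _
  have := h2.hasDerivAt_eq_zero h1
  simpa using this

/-- The Polyak–Łojasiewicz inequality: complete the square in the strong convexity bound. -/
theorem prox_sub_min_le {f : E → ℝ} (hf : Differentiable ℝ f)
    (hconv : ConvexOn ℝ Set.univ f) {H : ℝ} (hH : 0 < H) (z w x : E) :
    2 * H * (prox f H z x - prox f H z w) ≤ ‖proxGrad f H z x‖ ^ 2 := by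
  have h1 := prox_add_inner_le hf hconv H z x w
  have h2 := norm_add_sq_real (proxGrad f H z x) (H • (w - x))
  rw [inner_smul_right, norm_smul, mul_pow, Real.norm_eq_abs, sq_abs] at h2
  have h3 := sq_nonneg ‖proxGrad f H z x + H • (w - x)‖
  nlinarith

/-- An approximate minimizer of the proximal objective satisfies the stopping criterion. -/
theorem norm_proxGrad_le {f : E → ℝ} (hf : Differentiable ℝ f)
    (hconv : ConvexOn ℝ Set.univ f) {H L : ℝ} (hH : 0 < H) (hL : 0 ≤ L)
    (hlip : ∀ x y, ‖∇ f x - ∇ f y‖ ≤ L * ‖x - y‖) (z w v : E)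
    (hw : ∀ y, prox f H z w ≤ prox f H z y)
    (hv : (prox f H z v - prox f H z w) * ((1 + L / H) * (3 + 2 * L / H) ^ 2) ≤
      prox f H z z - prox f H z w) :
    ‖proxGrad f H z v‖ ≤ H / 2 * ‖v - z‖ := by
  have hG := proxGrad_eq_zero hf H z w hw
  have h1 := prox_add_inner_le hf hconv H z w v
  rw [hG, inner_zero_left, add_zero] at h1
  have h2 : prox f H z z - prox f H z w ≤ (L + H) / 2 * ‖z - w‖ ^ 2 := by
    have := prox_add_le hf H (L * ‖z - w‖ ^ 2) z w (z - w) (fun t ht => by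
      rw [← inner_sub_left]
      refine (real_inner_le_norm _ _).trans ?_
      have := hlip (w + t • (z - w)) w
      rw [add_sub_cancel_left, norm_smul, Real.norm_eq_abs, abs_of_nonneg ht] at this
      nlinarith [mul_le_mul_of_nonneg_right this (norm_nonneg (z - w))])
    rw [add_sub_cancel, hG, inner_zero_left] at this
    nlinarith
  have h3 : ‖proxGrad f H z v‖ ≤ (L + H) * ‖v - w‖ := by
    have e : proxGrad f H z v = (∇ f v - ∇ f w) + H • (v - w) := by
      rw [← sub_zero (proxGrad f H z v), ← hG]
      simp only [proxGrad, smul_sub]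
      abel
    rw [e]
    refine (norm_add_le _ _).trans ?_
    rw [norm_smul, Real.norm_eq_abs, abs_of_pos hH]
    linarith [hlip v w]
  -- Strong convexity bounds the gap at `v` below, smoothness bounds the gap at `z` above. The
  -- factor `1 + L/H` of `κ` cancels the condition number, and the square root of the rest remains.
  have h4 : ‖v - w‖ * (3 + 2 * L / H) ≤ ‖z - w‖ := by
    have hk : 0 < 1 + L / H := by positivity
    have h5 : H / 2 * ‖v - w‖ ^ 2 * ((1 + L / H) * (3 + 2 * L / H) ^ 2) ≤
        (L + H) / 2 * ‖z - w‖ ^ 2 :=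
      (mul_le_mul_of_nonneg_right (by linarith) (by positivity)).trans (hv.trans h2)
    have h6 : (L + H) / 2 = H / 2 * (1 + L / H) := by field_simp; ring
    rw [h6] at h5
    have h7 : (‖v - w‖ * (3 + 2 * L / H)) ^ 2 ≤ ‖z - w‖ ^ 2 := by
      have : 0 < H / 2 * (1 + L / H) := by positivity
      refine le_of_mul_le_mul_left ?_ this
      calc _ = _ := by ring
        _ ≤ _ := h5
    exact (pow_le_pow_iff_left₀ (by positivity) (by positivity) two_ne_zero).1 h7
  have h5 : ‖z - w‖ ≤ ‖v - z‖ + ‖v - w‖ := by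
    have := norm_sub_le (v - w) (v - z)
    rw [sub_sub_sub_cancel_left] at this
    linarith
  -- The triangle inequality uses up one of the three; `2 + 2L/H` is what turns `(L + H) ‖v - w‖`
  -- into `(H/2) ‖v - z‖`.
  have h6 : ‖v - w‖ * (2 + 2 * L / H) ≤ ‖v - z‖ := by nlinarith
  calc _ ≤ _ := h3
    _ = H / 2 * (‖v - w‖ * (2 + 2 * L / H)) := by field_simp; ring
    _ ≤ _ := by gcongr

/-- One step of the accelerated proximal extragradient method decreases the energy. -/
theorem energy_step {f : E → ℝ} (hf : Differentiable ℝ f)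
    (hconv : ConvexOn ℝ Set.univ f) {H A a : ℝ} (hA : 0 ≤ A) (ha : 0 < a)
    (haA : 2 * H * a ^ 2 = A + a) (x v₀ z v xstar : E)
    (hz : (A + a) • z = A • v₀ + a • x)
    (hv : ‖proxGrad f H z v‖ ≤ H / 2 * ‖v - z‖) :
    (A + a) * (f v - f xstar) + ‖x - a • ∇ f v - xstar‖ ^ 2 / 2 ≤
      A * (f v₀ - f xstar) + ‖x - xstar‖ ^ 2 / 2 := by
  set g := ∇ f v with hg
  -- Tangent inequalities at `v`, weighted by `A` and `a`. With the expansion of the new distance,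
  -- the terms in `x - xstar` cancel and only `(A + a) ⟪g, v - z⟫ + a² ‖g‖² / 2 ≤ 0` is left to
  -- show.
  have h1 := mul_le_mul_of_nonneg_left (add_inner_gradient_le hf hconv v v₀) hA
  have h2 := mul_le_mul_of_nonneg_left (add_inner_gradient_le hf hconv v xstar) ha.le
  rw [← hg] at h1 h2
  have h3 : ‖x - a • g - xstar‖ ^ 2 =
      ‖x - xstar‖ ^ 2 - 2 * a * ⟪g, x - xstar⟫_ℝ + a ^ 2 * ‖g‖ ^ 2 := by
    have := norm_add_sub_sq x (-(a • g)) xstar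
    rw [← sub_eq_add_neg] at this
    rw [this, inner_neg_right, inner_smul_right, norm_neg, norm_smul, mul_pow, Real.norm_eq_abs,
      sq_abs, real_inner_comm]
    ring
  have h4 : (A + a) * ⟪g, z⟫_ℝ = A * ⟪g, v₀⟫_ℝ + a * ⟪g, x⟫_ℝ := by
    rw [← inner_smul_right, hz, inner_add_right, inner_smul_right, inner_smul_right]
  -- Square the criterion: the terms `H² ‖v - z‖²` on the left exceed `H² ‖v - z‖² / 4` on the
  -- right.
  have h5 : 2 * H * ⟪g, v - z⟫_ℝ + ‖g‖ ^ 2 ≤ 0 := by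
    have h6 : ‖proxGrad f H z v‖ ^ 2 ≤ (H / 2 * ‖v - z‖) ^ 2 :=
      pow_le_pow_left₀ (norm_nonneg _) hv 2
    have h7 := norm_add_sq_real g (H • (v - z))
    rw [inner_smul_right, norm_smul, mul_pow, Real.norm_eq_abs, sq_abs] at h7
    simp only [proxGrad, ← hg] at h6
    nlinarith [mul_nonneg (sq_nonneg H) (sq_nonneg ‖v - z‖)]
  have h6 : (A + a) * ⟪g, v - z⟫_ℝ + a ^ 2 * ‖g‖ ^ 2 / 2 ≤ 0 := by
    rw [← haA]
    nlinarith [mul_nonpos_of_nonneg_of_nonpos (sq_nonneg a) h5, mul_nonneg (sq_nonneg a)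
      (sq_nonneg ‖g‖)]
  rw [h3]
  simp only [inner_sub_right] at *
  nlinarith

end Analysis

/-! ### One step of randomized coordinate descent -/

section CoordinateDescent

variable {n : ℕ}

/-- `∇ᵢ f` is `lᵢ`-Lipschitz along the `i`-th coordinate. -/
def CoordLip (f : EuclideanSpace ℝ (Fin n) → ℝ) (l : Fin n → ℝ) : Prop :=
  ∀ (i : Fin n) (x : EuclideanSpace ℝ (Fin n)) (u : ℝ),
    |(∇ f (x + u • EuclideanSpace.single i (1 : ℝ))) i - (∇ f x) i| ≤ l i * |u|

theorem CoordLip.nonneg {f : EuclideanSpace ℝ (Fin n) → ℝ} {l : Fin n → ℝ} (h : CoordLip f l)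
    (i : Fin n) : 0 ≤ l i := by
  simpa using (abs_nonneg _).trans (h i 0 1)

theorem inner_smul_single (g : EuclideanSpace ℝ (Fin n)) (i : Fin n) (u : ℝ) :
    ⟪g, u • EuclideanSpace.single i (1 : ℝ)⟫_ℝ = u * g i := by
  rw [inner_smul_right, EuclideanSpace.inner_single_right]
  simp

theorem prox_add_single_le {f : EuclideanSpace ℝ (Fin n) → ℝ} (hf : Differentiable ℝ f)
    {l : Fin n → ℝ} (hl : CoordLip f l) (H : ℝ) (z x : EuclideanSpace ℝ (Fin n)) (i : Fin n)
    (u : ℝ) :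
    prox f H z (x + u • EuclideanSpace.single i (1 : ℝ)) ≤
      prox f H z x + u * proxGrad f H z x i + (H + l i) / 2 * u ^ 2 := by
  have h := prox_add_le hf H (l i * u ^ 2) z x (u • EuclideanSpace.single i (1 : ℝ)) ?_
  · rw [inner_smul_single, norm_smul, mul_pow, Real.norm_eq_abs, sq_abs] at h
    simp only [PiLp.norm_single, norm_one] at h
    linarith
  · intro t ht
    rw [inner_smul_single, inner_smul_single, ← mul_sub, smul_smul]
    have h1 := hl i x (t * u)
    rw [abs_mul, abs_of_nonneg ht] at h1
    calc _ ≤ |u * ((∇ f (x + (t * u) • EuclideanSpace.single i (1 : ℝ))) i - (∇ f x) i)| :=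
          le_abs_self _
      _ ≤ |u| * (l i * (t * |u|)) := by rw [abs_mul]; gcongr
      _ = l i * |u| ^ 2 * t := by ring
      _ = _ := by rw [sq_abs]

/-- The result of the exact coordinate step. -/
noncomputable def coordStep (f : EuclideanSpace ℝ (Fin n) → ℝ) (l : Fin n → ℝ) (H : ℝ)
    (z y : Fin n → ℝ) (i : Fin n) : Fin n → ℝ :=
  Function.update y i
    (y i - 1 / (H + l i) * ((∇ f (WithLp.toLp 2 y)) i + H * (y i - z i)))

/-- The step goes to the minimizer of the quadratic upper bound `prox_add_single_le` along
coordinate `i`. -/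
theorem prox_coordStep_le {f : EuclideanSpace ℝ (Fin n) → ℝ} (hf : Differentiable ℝ f)
    {l : Fin n → ℝ} (hl : CoordLip f l) {H : ℝ} (hH : 0 < H) (z y : Fin n → ℝ) (i : Fin n) :
    prox f H (WithLp.toLp 2 z) (WithLp.toLp 2 (coordStep f l H z y i)) ≤
      prox f H (WithLp.toLp 2 z) (WithLp.toLp 2 y) -
        (proxGrad f H (WithLp.toLp 2 z) (WithLp.toLp 2 y) i) ^ 2 / (2 * (H + l i)) := by
  have hβ : 0 < H + l i := by linarith [hl.nonneg i]
  have e : WithLp.toLp 2 (coordStep f l H z y i) = WithLp.toLp 2 y +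
      (-(proxGrad f H (WithLp.toLp 2 z) (WithLp.toLp 2 y) i / (H + l i))) •
        EuclideanSpace.single i (1 : ℝ) := by
    ext k
    by_cases hk : k = i
    · subst hk
      simp [coordStep, proxGrad]
      ring
    · simp [coordStep, hk]
  rw [e]
  refine (prox_add_single_le hf hl H _ _ i _).trans (le_of_eq ?_)
  field_simp
  ring

theorem lawOf_apply [NeZero n] (w : Fin n → ℝ) (hw : ∀ i, 0 ≤ w i) (hs : ∑ i, w i = 1)
    (i : Fin n) : lawOf w i = ENNReal.ofReal (w i) := by
  have h : ∑' k, ENNReal.ofReal (w k) = 1 := by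
    rw [tsum_fintype, ← ENNReal.ofReal_sum_of_nonneg fun i _ => hw i, hs, ENNReal.ofReal_one]
  rw [lawOf, dif_pos (by rw [h]; exact one_ne_zero), PMF.normalize_apply, h, inv_one, mul_one]

/-- The expected decrease of the proximal objective in one step. -/
theorem expect_coordStep_le [NeZero n] {f : EuclideanSpace ℝ (Fin n) → ℝ}
    (hf : Differentiable ℝ f) (hconv : ConvexOn ℝ Set.univ f) {l : Fin n → ℝ}
    (hl : CoordLip f l) {H Z : ℝ} (hH : 0 < H) (hZ : ∑ i, (H + l i) = Z) (hHZ : H < Z)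
    (z y : Fin n → ℝ) (w : EuclideanSpace ℝ (Fin n))
    (hw : ∀ y, prox f H (WithLp.toLp 2 z) w ≤ prox f H (WithLp.toLp 2 z) y) :
    expect (lawOf fun i => (H + l i) / Z) (fun i => ENNReal.ofReal
        (prox f H (WithLp.toLp 2 z) (WithLp.toLp 2 (coordStep f l H z y i)) -
          prox f H (WithLp.toLp 2 z) w)) ≤
      ENNReal.ofReal (1 - H / Z) * ENNReal.ofReal
        (prox f H (WithLp.toLp 2 z) (WithLp.toLp 2 y) - prox f H (WithLp.toLp 2 z) w) := by
  have hZ0 : 0 < Z := hH.trans hHZ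
  have hβ : ∀ i, 0 < H + l i := fun i => by linarith [hl.nonneg i]
  have hp : ∀ i, 0 ≤ (H + l i) / Z := fun i => div_nonneg (hβ i).le hZ0.le
  have hs : ∑ i, (H + l i) / Z = 1 := by rw [← Finset.sum_div, hZ, div_self hZ0.ne']
  rw [expect, tsum_fintype]
  simp only [lawOf_apply _ hp hs, ← ENNReal.ofReal_mul (hp _)]
  rw [← ENNReal.ofReal_sum_of_nonneg fun i _ => mul_nonneg (hp i) (sub_nonneg.2 (hw _)),
    ← ENNReal.ofReal_mul (sub_nonneg.2 ((div_le_one hZ0).2 hHZ.le))]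
  refine ENNReal.ofReal_le_ofReal ?_
  set P := prox f H (WithLp.toLp 2 z) with hP
  set G := proxGrad f H (WithLp.toLp 2 z) (WithLp.toLp 2 y) with hG
  calc ∑ i, (H + l i) / Z * (P (WithLp.toLp 2 (coordStep f l H z y i)) - P w)
      ≤ ∑ i, ((H + l i) / Z * (P (WithLp.toLp 2 y) - P w) - (G i) ^ 2 / (2 * Z)) := by
        refine Finset.sum_le_sum fun i _ => ?_
        have h1 := mul_le_mul_of_nonneg_left (prox_coordStep_le hf hl hH z y i) (hp i)
        -- The sampling weight cancels the curvature of the coordinate, so the expected decreases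
        -- add up to the full `‖G‖² / (2Z)`.
        have h2 : (H + l i) / Z * ((G i) ^ 2 / (2 * (H + l i))) = (G i) ^ 2 / (2 * Z) := by
          have := (hβ i).ne'
          field_simp
        rw [mul_sub, h2] at h1
        rw [mul_sub, mul_sub]
        linarith
    _ = (P (WithLp.toLp 2 y) - P w) - ‖G‖ ^ 2 / (2 * Z) := by
        rw [Finset.sum_sub_distrib, ← Finset.sum_mul, hs, one_mul, ← Finset.sum_div,
          EuclideanSpace.real_norm_sq_eq]
    _ ≤ (1 - H / Z) * (P (WithLp.toLp 2 y) - P w) := by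
        have h1 := prox_sub_min_le hf hconv hH (WithLp.toLp 2 z) w (WithLp.toLp 2 y)
        have h2 : H / Z * (P (WithLp.toLp 2 y) - P w) ≤ ‖G‖ ^ 2 / (2 * Z) := by
          rw [div_mul_eq_mul_div, div_le_div_iff₀ hZ0 (by positivity)]
          nlinarith
        linarith

end CoordinateDescent

/-! ### The inner loop -/

section Inner

variable {n : ℕ} [NeZero n]

theorem wp_innerStep (f : EuclideanSpace ℝ (Fin n) → ℝ)
    (τ : EuclideanSpace ℝ (Fin n) → Fin n → ℕ) (m : Mem n) (φ : Mem n → ℝ≥0∞) :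
    wp (innerStep.exec (gradOracle f τ) m) φ = expect m.smp fun t => φ { m with
      idx := Function.update m.idx .i t
      sc := Function.update m.sc .g ((∇ f (WithLp.toLp 2 (m.arr .y))) t)
      arr := Function.update m.arr .y
        (coordStep f (m.arr .lip) (m.sc .H) (m.arr .xt) (m.arr .y) t) } := by
  simp only [innerStep, block, wp_seq]
  simp only [Cmd.exec, wp_pure]
  simp only [wp, expect_map, Expr.eval, smoothness, gradOracle, coordStep]
  simp

open Classical in
/-- The suboptimality of the iterate, infinite if anything else than the iterate has changed. -/
noncomputable def gap (f : EuclideanSpace ℝ (Fin n) → ℝ) (H : ℝ) (w : EuclideanSpace ℝ (Fin n))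
    (m₀ m : Mem n) : ℝ≥0∞ :=
  if Agree (· = .g) (· = .y) m₀ m then
    ENNReal.ofReal (prox f H (WithLp.toLp 2 (m₀.arr .xt)) (WithLp.toLp 2 (m.arr .y)) -
      prox f H (WithLp.toLp 2 (m₀.arr .xt)) w)
  else ⊤

theorem wp_innerStep_gap_le {f : EuclideanSpace ℝ (Fin n) → ℝ}
    (τ : EuclideanSpace ℝ (Fin n) → Fin n → ℕ) (hf : Differentiable ℝ f)
    (hconv : ConvexOn ℝ Set.univ f) {l : Fin n → ℝ} (hl : CoordLip f l) {H Z : ℝ} (hH : 0 < H)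
    (hZ : ∑ i, (H + l i) = Z) (hHZ : H < Z) (w : EuclideanSpace ℝ (Fin n)) (m₀ : Mem n)
    (hw : ∀ y, prox f H (WithLp.toLp 2 (m₀.arr .xt)) w ≤
      prox f H (WithLp.toLp 2 (m₀.arr .xt)) y)
    (h₁ : m₀.sc .H = H) (h₂ : m₀.arr .lip = l) (h₃ : m₀.smp = lawOf fun i => (H + l i) / Z)
    (m : Mem n) :
    wp (innerStep.exec (gradOracle f τ) m) (gap f H w m₀) ≤
      ENNReal.ofReal (1 - H / Z) * gap f H w m₀ m := by
  by_cases hm : Agree (· = .g) (· = .y) m₀ m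
  · have e₁ : m.sc .H = H := (hm.sc .H (by simp)).trans h₁
    have e₂ : m.arr .lip = l := (hm.arr .lip (by simp)).trans h₂
    have e₃ : m.arr .xt = m₀.arr .xt := hm.arr .xt (by simp)
    rw [wp_innerStep, hm.smp, h₃, e₁, e₂, e₃]
    refine (expect_mono _ fun t _ => ?_).trans ((expect_coordStep_le hf hconv hl hH hZ hHZ
      (m₀.arr .xt) (m.arr .y) w hw).trans_eq ?_)
    · rw [gap, if_pos]
      · simp
      · refine ⟨fun r hr => ?_, fun b hb => ?_, hm.cnt, h₃.symm⟩
        · simpa [Function.update_of_ne hr] using hm.sc r hr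
        · simpa [Function.update_of_ne hb] using hm.arr b hb
    · rw [gap, if_pos hm]
  -- Off the frame the bound is `⊤`, because `H < Z` strictly makes the contraction factor nonzero.
  · rw [gap, if_neg hm, ENNReal.mul_top]
    · exact le_top
    · rw [Ne, ENNReal.ofReal_eq_zero, not_le, sub_pos, div_lt_one (hH.trans hHZ)]
      exact hHZ

/-- From `1 - x ≤ exp (-x)`. -/
theorem pow_innerCount_le {H Z η : ℝ} (hH : 0 < H) (hHZ : H < Z) (hη : 0 < η) (k : ℕ)
    (hk : Z / H * Real.log (1 / η) ≤ k) : (1 - H / Z) ^ k ≤ η := by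
  have hZ : 0 < Z := hH.trans hHZ
  have h1 : 1 - H / Z ≤ Real.exp (-(H / Z)) := by
    have := Real.add_one_le_exp (-(H / Z))
    linarith
  have h0 : 0 ≤ 1 - H / Z := sub_nonneg.2 ((div_le_one hZ).2 hHZ.le)
  refine (pow_le_pow_left₀ h0 h1 k).trans ?_
  rw [← Real.exp_nat_mul, ← Real.le_log_iff_exp_le hη]
  have h2 := mul_le_mul_of_nonneg_right hk (div_pos hH hZ).le
  rw [mul_comm, ← mul_assoc, div_mul_div_cancel₀ hZ.ne', div_self hH.ne', one_mul, one_div,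
    Real.log_inv] at h2
  linarith

open Classical in
/-- Coordinate descent meets the stopping criterion with high probability. -/
theorem wp_loop_innerStep_le {f : EuclideanSpace ℝ (Fin n) → ℝ}
    (τ : EuclideanSpace ℝ (Fin n) → Fin n → ℕ) (hf : Differentiable ℝ f)
    (hconv : ConvexOn ℝ Set.univ f) {l : Fin n → ℝ} (hl : CoordLip f l) {H Z L η : ℝ}
    (hH : 0 < H) (hL : 0 ≤ L) (hlip : ∀ x y, ‖∇ f x - ∇ f y‖ ≤ L * ‖x - y‖)
    {xstar : EuclideanSpace ℝ (Fin n)} (hmin : ∀ x, f xstar ≤ f x)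
    (hZ : ∑ i, (H + l i) = Z) (hHZ : H < Z) (hη : 0 < η) (m₀ : Mem n)
    (h₁ : m₀.sc .H = H) (h₂ : m₀.arr .lip = l) (h₃ : m₀.smp = lawOf fun i => (H + l i) / Z)
    (h₄ : m₀.arr .y = m₀.arr .xt)
    (hcnt : Z / H * Real.log (1 / η * (1 + L / H) * (3 + 2 * L / H) ^ 2) ≤ m₀.cnt .inner) :
    wp ((Cmd.loop .inner innerStep).exec (gradOracle f τ) m₀)
      (fun m => if Agree (· = .g) (· = .y) m₀ m ∧
        ‖proxGrad f H (WithLp.toLp 2 (m₀.arr .xt)) (WithLp.toLp 2 (m.arr .y))‖ ≤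
          H / 2 * ‖WithLp.toLp 2 (m.arr .y) - WithLp.toLp 2 (m₀.arr .xt)‖ then 0 else 1) ≤
      ENNReal.ofReal η := by
  set z : EuclideanSpace ℝ (Fin n) := WithLp.toLp 2 (m₀.arr .xt) with hz
  obtain ⟨w, hw⟩ := exists_prox_min hf.continuous hH z xstar hmin
  set κ := (1 + L / H) * (3 + 2 * L / H) ^ 2 with hκ
  have hκ0 : 0 < κ := by positivity
  set D := prox f H z z - prox f H z w with hD
  have hD0 : 0 ≤ D := sub_nonneg.2 (hw z)
  -- Markov at the threshold `D/κ` required by `norm_proxGrad_le`; the expected gap is at most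
  -- `(η/κ) D`. A finite gap also certifies that nothing else in memory changed.
  refine expect_indicator_le _ _ (φ := fun r => gap f H w m₀ r.1) (b := ENNReal.ofReal (D / κ))
    ENNReal.ofReal_ne_top ?_ ?_
  · refine (wp_iter_le _ _ _ (wp_innerStep_gap_le τ hf hconv hl hH hZ hHZ w m₀ hw h₁ h₂ h₃) _
      m₀).trans ?_
    rw [gap, if_pos (Agree.refl _ _ _), h₄, ← hz, ← hD, ← ENNReal.ofReal_mul hη.le,
      ← ENNReal.ofReal_pow (sub_nonneg.2 ((div_le_one (hH.trans hHZ)).2 hHZ.le)),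
      ← ENNReal.ofReal_mul (pow_nonneg (sub_nonneg.2 ((div_le_one (hH.trans hHZ)).2 hHZ.le)) _)]
    refine ENNReal.ofReal_le_ofReal ?_
    have h5 := pow_innerCount_le hH hHZ (div_pos hη hκ0) (m₀.cnt .inner) (by
      convert hcnt using 3
      rw [hκ]
      field_simp)
    calc _ ≤ η / κ * D := mul_le_mul_of_nonneg_right h5 hD0
      _ = _ := by ring
  · intro r _ hr
    by_cases hA : Agree (· = .g) (· = .y) m₀ r.1
    · refine ⟨hA, norm_proxGrad_le hf hconv hH hL hlip z w _ hw ?_⟩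
      rw [gap, if_pos hA, ENNReal.ofReal_le_ofReal_iff (div_nonneg hD0 hκ0.le),
        le_div_iff₀ hκ0] at hr
      exact hr
    · rw [gap, if_neg hA, top_le_iff] at hr
      exact absurd hr ENNReal.ofReal_ne_top

end Inner

/-! ### The outer step and its invariant -/

section Outer

variable {n : ℕ} [NeZero n]

theorem sat_assign (O : Oracle n) {r : Scalar} {e : Expr} {m : Mem n} {Q : Mem n → Prop}
    (h : Q { m with sc := Function.update m.sc r (e.eval m) }) :
    Sat ((Cmd.assign r e).exec O m) Q := sat_pure h

theorem sat_gradientStep (O : Oracle n) (m : Mem n) :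
    Sat ((Cmd.forAll .j (.seq (.call .g .v .j)
      (.store .x .j (.sub (.get .x .j) (.mul (.var .a) (.var .g)))))).exec O m)
      fun m' => Agree (· = .g) (· = .x) m m' ∧
        m'.arr .x = fun i => m.arr .x i - m.sc .a * O.val (m.arr .v) i := by
  have h := sat_forAll O (k := .j) (c := .seq (.call .g .v .j)
      (.store .x .j (.sub (.get .x .j) (.mul (.var .a) (.var .g))))) (m := m)
    (fun S m' => Agree (· = .g) (· = .x) m m' ∧
      (∀ i, S i → m'.arr .x i = m.arr .x i - m.sc .a * O.val (m.arr .v) i) ∧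
      ∀ i, ¬ S i → m'.arr .x i = m.arr .x i) ?_
    ⟨Agree.refl _ _ _, fun _ h => h.elim, fun _ _ => rfl⟩
  · intro r hr
    obtain ⟨h1, h2, -⟩ := h r hr
    exact ⟨h1, funext fun i => h2 i trivial⟩
  · rintro S t m' ht ⟨h1, h2, h3⟩
    have ha : m'.sc .a = m.sc .a := h1.sc .a (by simp)
    have hv : m'.arr .v = m.arr .v := h1.arr .v (by simp)
    refine sat_seq O (sat_pure rfl : Sat _ fun m'' => m'' = _) ?_
    rintro m'' rfl
    refine sat_pure ⟨⟨fun r hr => ?_, fun b' hb' => ?_, h1.cnt, h1.smp⟩, fun i hi => ?_,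
      fun i hi => ?_⟩
    · simpa [Function.update_of_ne hr] using h1.sc r hr
    · simpa [Function.update_of_ne hb'] using h1.arr b' hb'
    · by_cases hit : i = t
      · subst hit
        simp [Expr.eval, ha, hv, h3 i ht]
      · simpa [hit] using h2 i (by tauto)
    · have hit : i ≠ t := fun h => hi (Or.inr h)
      simpa [hit] using h3 i fun h => hi (Or.inl h)

open Classical in
theorem sat_sumStep (O : Oracle n) (m : Mem n) :
    Sat ((Cmd.forAll .j (.assign .Z (.add (.var .Z) (smoothness .j)))).exec O m)
      fun m' => Agree (· = .Z) (fun _ => False) m m' ∧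
        m'.sc .Z = m.sc .Z + ∑ i, (m.sc .H + m.arr .lip i) := by
  have h := sat_forAll O (k := .j) (c := .assign .Z (.add (.var .Z) (smoothness .j))) (m := m)
    (fun S m' => Agree (· = .Z) (fun _ => False) m m' ∧
      m'.sc .Z = m.sc .Z + ∑ i with S i, (m.sc .H + m.arr .lip i)) ?_
    ⟨Agree.refl _ _ _, by simp⟩
  · simpa using h
  · rintro S t m' ht ⟨h1, h2⟩
    have hH : m'.sc .H = m.sc .H := h1.sc .H (by simp)
    have hl : m'.arr .lip = m.arr .lip := h1.arr .lip (by simp)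
    refine sat_assign O ⟨⟨fun r hr => ?_, h1.arr, h1.cnt, h1.smp⟩, ?_⟩
    · simpa [Function.update_of_ne hr] using h1.sc r hr
    · have e : @Finset.filter _ (fun i => S i ∨ i = t) (fun _ => Classical.propDecidable _)
          Finset.univ = insert t (Finset.univ.filter S) := by
        ext i
        simp [or_comm]
      beta_reduce
      rw [e, Finset.sum_insert (by simpa using ht)]
      simp [Expr.eval, smoothness, hH, hl, h2]
      ring

/-- The state before the `k`-th outer step, as long as no inner loop has failed. -/
structure Inv (f : EuclideanSpace ℝ (Fin n) → ℝ) (l : Fin n → ℝ) (H Z R : ℝ)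
    (xstar : EuclideanSpace ℝ (Fin n)) (t : Cnt → ℕ) (k : ℕ) (m : Mem n) : Prop where
  H_eq : m.sc .H = H
  lam_eq : m.sc .lam = 1 / (2 * H)
  lip_eq : m.arr .lip = l
  smp_eq : m.smp = lawOf fun i => (H + l i) / Z
  cnt_eq : m.cnt = t
  le_A : (k : ℝ) ^ 2 / (8 * H) ≤ m.sc .A
  energy : m.sc .A * (f (WithLp.toLp 2 (m.arr .v)) - f xstar) +
    ‖WithLp.toLp 2 (m.arr .x) - xstar‖ ^ 2 / 2 ≤ R ^ 2 / 2

theorem sat_setup (f : EuclideanSpace ℝ (Fin n) → ℝ) (O : Oracle n) (l : Fin n → ℝ) (H R : ℝ)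
    (x₀ xstar : EuclideanSpace ℝ (Fin n)) (hR : ‖x₀ - xstar‖ = R) (N M : ℕ) :
    Sat (setup.exec O (input H x₀.ofLp l N M))
      (Inv f l H (∑ i, (H + l i)) R xstar (input (n := n) H x₀.ofLp l N M).cnt 0) := by
  set m₀ : Mem n := input H x₀.ofLp l N M with hm₀
  have H₀ : m₀.sc .H = H := by simp [hm₀, input]
  have l₀ : m₀.arr .lip = l := by simp [hm₀, input]
  have x₀' : m₀.arr .x = x₀.ofLp := by simp [hm₀, input]
  simp only [setup, block]
  refine sat_seq O (sat_assign O rfl : Sat _ fun m => m = _) ?_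
  rintro m rfl
  refine sat_seq O (sat_assign O rfl : Sat _ fun m => m = _) ?_
  rintro m rfl
  set m₁ : Mem n := Mem.mk _ _ _ _ _ with hm₁
  have H₁ : m₁.sc .H = H := by simp [hm₁, H₀]
  have lam₁ : m₁.sc .lam = 1 / (2 * H) := by simp [hm₁, Expr.eval, H₀]
  have A₁ : m₁.sc .A = 0 := by simp [hm₁, Expr.eval]
  have l₁ : m₁.arr .lip = l := l₀
  have x₁ : m₁.arr .x = x₀.ofLp := x₀'
  have c₁ : m₁.cnt = m₀.cnt := rfl
  clear_value m₁
  refine sat_seq O (sat_forAll_store O .v (.get .x .j) m₁ x₀.ofLp ?_) ?_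
  · intro m' t hA _ ht
    simp [Expr.eval, ht, hA.arr .x (by simp), x₁]
  rintro m₂ ⟨h₂, v₂⟩
  refine sat_seq O (sat_assign O rfl : Sat _ fun m => m = _) ?_
  rintro m₃ rfl
  refine sat_seq O (sat_sumStep O _) ?_
  rintro m₄ ⟨h₄, Z₄⟩
  have H₄ : m₄.sc .H = H := by rw [h₄.sc _ (by simp)]; simp [h₂.sc, H₁]
  have lam₄ : m₄.sc .lam = 1 / (2 * H) := by rw [h₄.sc _ (by simp)]; simp [h₂.sc, lam₁]
  have A₄ : m₄.sc .A = 0 := by rw [h₄.sc _ (by simp)]; simp [h₂.sc, A₁]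
  have l₄ : m₄.arr .lip = l := by
    rw [h₄.arr _ (by simp)]
    exact (h₂.arr _ (by simp)).trans l₁
  have x₄ : m₄.arr .x = x₀.ofLp := by
    rw [h₄.arr _ (by simp)]
    exact (h₂.arr _ (by simp)).trans x₁
  have v₄ : m₄.arr .v = x₀.ofLp := by
    rw [h₄.arr _ (by simp)]
    exact v₂
  have c₄ : m₄.cnt = m₀.cnt := h₄.cnt.trans (h₂.cnt.trans c₁)
  have Z₄' : m₄.sc .Z = ∑ i, (H + l i) := by
    rw [Z₄]
    simp [h₂.sc, H₁, Expr.eval, h₂.arr, l₁]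
  clear Z₄ h₄
  refine sat_seq O (sat_forAll_store O .p (.div (smoothness .j) (.var .Z)) m₄
    (fun i => (H + l i) / ∑ i, (H + l i)) ?_) ?_
  · intro m' t hA _ ht
    simp [Expr.eval, smoothness, ht, hA.arr .lip (by simp), hA.sc, l₄, H₄, Z₄']
  rintro m₅ ⟨h₅, p₅⟩
  refine sat_pure ⟨?_, ?_, ?_, ?_, ?_, ?_, ?_⟩
  · simp [h₅.sc, H₄]
  · simp [h₅.sc, lam₄]
  · simp [h₅.arr, l₄]
  · simp [p₅]
  · exact h₅.cnt.trans c₄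
  · simp [h₅.sc, A₄]
  · simp [h₅.sc, A₄, h₅.arr, x₄, hR]

/-- `a` is the positive root of `a² = lam (A + a)`. -/
theorem stepSize_spec {H A : ℝ} (hH : 0 < H) (hA : 0 ≤ A) :
    let lam := 1 / (2 * H)
    let a := (lam + √(lam * lam + 4 * (lam * A))) / 2
    0 < a ∧ 2 * H * a ^ 2 = A + a := by
  intro lam a
  have hl : 0 < lam := by positivity
  refine ⟨by positivity, ?_⟩
  have hs : √(lam * lam + 4 * (lam * A)) ^ 2 = lam * lam + 4 * (lam * A) :=
    Real.sq_sqrt (by positivity)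
  have h1 : a ^ 2 = lam * (A + a) := by
    simp only [a]
    linear_combination hs / 4
  rw [h1]
  simp only [lam]
  field_simp

/-- With `b = 4Ha` one has `8H(A + a) = b²` and `8HA = b² - 2b ≥ k²`. Hence `(b - 1)² > k²`, so `b ≥
k + 1`. -/
theorem stepSize_growth {H A a k : ℝ} (hH : 0 < H) (hk : 0 ≤ k) (ha : 0 < a)
    (haA : 2 * H * a ^ 2 = A + a) (hA : k ^ 2 / (8 * H) ≤ A) :
    (k + 1) ^ 2 / (8 * H) ≤ A + a := by
  rw [div_le_iff₀ (by positivity)] at *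
  have h1 : k + 1 ≤ 4 * H * a := by
    have h2 : k ^ 2 + 2 * (4 * H * a) ≤ (4 * H * a) ^ 2 := by nlinarith
    have h3 : 0 < 4 * H * a := by positivity
    have h4 : 2 ≤ 4 * H * a := le_of_mul_le_mul_right (by nlinarith) h3
    by_contra! h
    have := pow_le_pow_left₀ (by linarith : 0 ≤ 4 * H * a - 1) (by linarith : _ ≤ k) 2
    linarith
  have : (A + a) * (8 * H) = (4 * H * a) ^ 2 := by rw [← haA]; ring
  rw [this]
  exact pow_le_pow_left₀ (by linarith) h1 2

open Classical in
-- The inner loop is the only random command; the others are followed exactly by sure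
-- postconditions. So the invariant can be lost only if the inner loop misses its criterion.
theorem wp_outerStep_le {f : EuclideanSpace ℝ (Fin n) → ℝ}
    (τ : EuclideanSpace ℝ (Fin n) → Fin n → ℕ) (hf : Differentiable ℝ f)
    (hconv : ConvexOn ℝ Set.univ f) {l : Fin n → ℝ} (hl : CoordLip f l) {H Z L η R : ℝ}
    (hH : 0 < H) (hL : 0 ≤ L) (hlip : ∀ x y, ‖∇ f x - ∇ f y‖ ≤ L * ‖x - y‖)
    {xstar : EuclideanSpace ℝ (Fin n)} (hmin : ∀ x, f xstar ≤ f x)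
    (hZ : ∑ i, (H + l i) = Z) (hHZ : H < Z) (hη : 0 < η) (t : Cnt → ℕ)
    (hcnt : Z / H * Real.log (1 / η * (1 + L / H) * (3 + 2 * L / H) ^ 2) ≤ t .inner)
    (k : ℕ) (m : Mem n) (hm : Inv f l H Z R xstar t k m) :
    wp (outerStep.exec (gradOracle f τ) m)
      (fun m' => if Inv f l H Z R xstar t (k + 1) m' then 0 else 1) ≤ ENNReal.ofReal η := by
  obtain ⟨H₀, lam₀, l₀, smp₀, cnt₀, hkA, hE⟩ := hm
  set A := m.sc .A with hA
  set a := (1 / (2 * H) + √(1 / (2 * H) * (1 / (2 * H)) + 4 * (1 / (2 * H) * A))) / 2 with ha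
  have hA0 : 0 ≤ A := le_trans (by positivity) hkA
  obtain ⟨ha0, haA⟩ : 0 < a ∧ 2 * H * a ^ 2 = A + a := stepSize_spec hH hA0
  simp only [outerStep, block]
  rw [wp_seq, wp_assign, wp_seq, wp_assign, wp_seq]
  set m₁ : Mem n := Mem.mk _ _ _ _ _ with hm₁
  have H₁ : m₁.sc .H = H := by simp [hm₁, H₀]
  have lam₁ : m₁.sc .lam = 1 / (2 * H) := by simp [hm₁, lam₀]
  have a₁ : m₁.sc .a = a := by simp [hm₁, Expr.eval, lam₀, ha, hA]
  have A₁ : m₁.sc .A = A := by simp [hm₁, hA]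
  have An₁ : m₁.sc .Anext = A + a := by simp [hm₁, Expr.eval, lam₀, ha, hA]
  have arr₁ : m₁.arr = m.arr := rfl
  have smp₁ : m₁.smp = m.smp := rfl
  have cnt₁ : m₁.cnt = m.cnt := rfl
  clear_value m₁
  refine wp_le_of_sat (sat_forAll_store _ .xt _ m₁
    (fun i => (A * m.arr .v i + a * m.arr .x i) / (A + a)) ?_) ?_
  · intro m' t hA _ ht
    simp [Expr.eval, ht, hA.arr, hA.sc, arr₁, A₁, a₁, An₁]
  rintro m₂ ⟨h₂, xt₂⟩
  rw [wp_seq, wp_assign, wp_seq]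
  refine wp_le_of_sat (sat_forAll_store _ .y _ _
    (fun i => (A * m.arr .v i + a * m.arr .x i) / (A + a)) ?_) ?_
  · intro m' t hA _ ht
    simp [Expr.eval, ht, hA.arr, xt₂]
  rintro m₃ ⟨h₃, y₃⟩
  have H₃ : m₃.sc .H = H := by simp [h₃.sc, h₂.sc, H₁]
  have lam₃ : m₃.sc .lam = 1 / (2 * H) := by simp [h₃.sc, h₂.sc, lam₁]
  have a₃ : m₃.sc .a = a := by simp [h₃.sc, h₂.sc, a₁]
  have A₃ : m₃.sc .A = A + a := by simp [h₃.sc, h₂.sc, An₁, Expr.eval]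
  have l₃ : m₃.arr .lip = l := by simp [h₃.arr, h₂.arr, arr₁, l₀]
  have x₃ : m₃.arr .x = m.arr .x := by simp [h₃.arr, h₂.arr, arr₁]
  have xt₃ : m₃.arr .xt = m₃.arr .y := by rw [y₃, ← xt₂]; simp [h₃.arr]
  have smp₃ : m₃.smp = m.smp := h₃.smp.trans (h₂.smp.trans smp₁)
  have cnt₃ : m₃.cnt = t := h₃.cnt.trans (h₂.cnt.trans (cnt₁.trans cnt₀))
  rw [← xt₃] at y₃
  set z : EuclideanSpace ℝ (Fin n) := WithLp.toLp 2 (m₃.arr .xt) with hz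
  have hzeq : (A + a) • z = A • WithLp.toLp 2 (m.arr .v) + a • WithLp.toLp 2 (m.arr .x) := by
    ext i
    have : A + a ≠ 0 := by positivity
    simp [hz, y₃]
    field_simp
  clear h₃ h₂
  rw [wp_seq]
  -- Compare failure indicators pointwise: after a good inner loop the rest fails with probability
  -- zero, after a bad one the bound is `1`.
  refine le_trans (expect_mono _ fun r _ => ?_) (wp_loop_innerStep_le τ hf hconv hl hH hL hlip
    hmin hZ hHZ hη m₃ H₃ l₃ (smp₃.trans smp₀) xt₃.symm (by rw [cnt₃]; exact hcnt))
  obtain ⟨m₄, cost⟩ := r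
  dsimp only
  split_ifs with hgood
  · obtain ⟨h₄, hg⟩ := hgood
    rw [wp_seq]
    refine wp_le_of_sat (sat_forAll_store _ .v (.get .y .j) m₄ (m₄.arr .y) ?_) ?_
    · intro m' t hA _ ht
      simp [Expr.eval, ht, hA.arr]
    rintro m₅ ⟨h₅, v₅⟩
    refine wp_le_of_sat (sat_gradientStep _ m₅) ?_
    rintro m₆ ⟨h₆, x₆⟩
    rw [if_pos]
    have v₆ : m₆.arr .v = m₄.arr .y := by simp [h₆.arr, v₅]
    have x₆' : WithLp.toLp 2 (m₆.arr .x) = WithLp.toLp 2 (m.arr .x) -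
        a • ∇ f (WithLp.toLp 2 (m₄.arr .y)) := by
      rw [x₆]
      ext i
      simp [gradOracle, h₅.arr, h₄.arr, x₃, h₅.sc, h₄.sc, a₃, v₅]
    have A₆ : m₆.sc .A = A + a := by simp [h₆.sc, h₅.sc, h₄.sc, A₃]
    refine ⟨?_, ?_, ?_, ?_, ?_, ?_, ?_⟩
    · simp [h₆.sc, h₅.sc, h₄.sc, H₃]
    · simp [h₆.sc, h₅.sc, h₄.sc, lam₃]
    · simp [h₆.arr, h₅.arr, h₄.arr, l₃]
    · exact h₆.smp.trans (h₅.smp.trans (h₄.smp.trans (smp₃.trans smp₀)))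
    · exact h₆.cnt.trans (h₅.cnt.trans (h₄.cnt.trans cnt₃))
    · rw [A₆]
      push_cast
      exact stepSize_growth hH k.cast_nonneg ha0 haA hkA
    · rw [A₆, v₆, x₆']
      exact (energy_step hf hconv hA0 ha0 haA _ _ z _ xstar hzeq hg).trans hE
  · refine expect_le _ fun r _ => ?_
    dsimp only
    split_ifs <;> simp

end Outer

/-! ### Bounds on the iteration numbers and the total cost -/

section Counts

theorem sqrt_ratio_ge_one {H R ε : ℝ} (hε : 0 < ε) (hεR : ε ≤ H * R ^ 2) :
    1 ≤ √(H * R ^ 2 / ε) :=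
  Real.one_le_sqrt.2 ((one_le_div hε).2 hεR)

theorem outerCount_le {H R ε : ℝ} (hε : 0 < ε) (hεR : ε ≤ H * R ^ 2) :
    (outerCount H R ε : ℝ) ≤ 5 * √(H * R ^ 2 / ε) := by
  have h1 := sqrt_ratio_ge_one hε hεR
  -- With the root `q ≥ 1`, this gives `(16/5) q + 1 ≤ 5q`.
  have h2 : √15 ≤ 4 := Real.sqrt_le_iff.2 (by norm_num)
  have h3 : (outerCount H R ε : ℝ) < 4 * √15 / 5 * √(H * R ^ 2 / ε) + 1 :=
    Nat.ceil_lt_add_one (by positivity)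
  nlinarith

theorem outerCount_pos {H R ε : ℝ} (hε : 0 < ε) (hεR : ε ≤ H * R ^ 2) :
    0 < outerCount H R ε := by
  have h1 := sqrt_ratio_ge_one hε hεR
  exact Nat.ceil_pos.2 (by positivity)

theorem le_outerCount_sq {H R ε : ℝ} (hε : 0 < ε) (hεR : ε ≤ H * R ^ 2) :
    48 / 5 * (H * R ^ 2 / ε) ≤ (outerCount H R ε : ℝ) ^ 2 := by
  have h1 : 4 * √15 / 5 * √(H * R ^ 2 / ε) ≤ (outerCount H R ε : ℝ) := Nat.le_ceil _
  have h2 := pow_le_pow_left₀ (by positivity) h1 2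
  rw [mul_pow, div_pow, mul_pow, Real.sq_sqrt (by norm_num),
    Real.sq_sqrt (div_nonneg (hε.le.trans hεR) hε.le)] at h2
  linarith

/-- For small `√ε δ` the factor `5 √(HR²) κ` is at most `1 / (√ε δ)`, so the logarithm at most
doubles. As `Z/H = 2n`, the count is at most `4nℓ + 1 ≤ 5nℓ`. -/
theorem innerCount_le {n : ℕ} [NeZero n] {H L R ε δ : ℝ} {l : Fin n → ℝ} (hH : 0 < H)
    (hL : 0 ≤ L) (hR : 0 < R) (hZ : ∑ i, (H + l i) = 2 * n * H) (hε : 0 < ε)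
    (hεR : ε ≤ H * R ^ 2) (hδ : 0 < δ)
    (h₁ : 1 ≤ Real.log (1 / (√ε * δ)))
    (h₂ : √ε * δ ≤ 1 / (5 * √(H * R ^ 2) * ((1 + L / H) * (3 + 2 * L / H) ^ 2))) :
    (innerCount H L l (outerCount H R ε) δ : ℝ) ≤ 5 * n * Real.log (1 / (√ε * δ)) := by
  set ℓ := Real.log (1 / (√ε * δ)) with hℓ
  set κ := (1 + L / H) * (3 + 2 * L / H) ^ 2 with hκ
  have hκ0 : 0 < κ := by positivity
  have hs : 0 < √ε := Real.sqrt_pos.2 hε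
  have hHR : 0 < √(H * R ^ 2) := Real.sqrt_pos.2 (by positivity)
  have hN : (0 : ℝ) < outerCount H R ε := Nat.cast_pos.2 (outerCount_pos hε hεR)
  have h3 : Real.log (outerCount H R ε / δ * (1 + L / H) * (3 + 2 * L / H) ^ 2) ≤ 2 * ℓ := by
    rw [mul_assoc, ← hκ, two_mul, hℓ, ← Real.log_mul (by positivity) (by positivity)]
    refine Real.log_le_log (by positivity) ?_
    calc _ ≤ 5 * √(H * R ^ 2 / ε) / δ * κ := by
          gcongr
          exact outerCount_le hε hεR
      _ = (5 * √(H * R ^ 2) * κ) * (1 / (√ε * δ)) := by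
          rw [Real.sqrt_div (by positivity)]
          field_simp
      _ ≤ _ := by
          refine mul_le_mul_of_nonneg_right ?_ (by positivity)
          rwa [le_one_div (by positivity) (by positivity)] at h₂
  have hn : (1 : ℝ) ≤ n := Nat.one_le_cast.2 (NeZero.one_le)
  have h4 : innerCount H L l (outerCount H R ε) δ ≤ ⌈2 * n * (2 * ℓ)⌉₊ := by
    rw [innerCount, hZ, mul_div_cancel_right₀ _ hH.ne']
    exact Nat.ceil_mono (mul_le_mul_of_nonneg_left h3 (by positivity))
  have h5 : (⌈2 * n * (2 * ℓ)⌉₊ : ℝ) < 2 * n * (2 * ℓ) + 1 :=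
    Nat.ceil_lt_add_one (by positivity)
  have h6 : (innerCount H L l (outerCount H R ε) δ : ℝ) ≤ ⌈2 * n * (2 * ℓ)⌉₊ := by
    exact_mod_cast h4
  nlinarith

theorem bound_method_le (n : ℕ) (hn : 1 ≤ n) (K : ℝ) (t : Cnt → ℕ) :
    method.bound n K t ≤ 100 * n + t .outer * (100 * n + t .inner * (K + 100) + n * (K + 100)) := by
  have hn' : (1 : ℝ) ≤ n := by exact_mod_cast hn
  have hN : (0 : ℝ) ≤ t .outer := Nat.cast_nonneg _
  have hM : (0 : ℝ) ≤ t .inner := Nat.cast_nonneg _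
  simp only [method, setup, outerStep, innerStep, block, smoothness, Cmd.bound, Expr.cost]
  push_cast
  refine add_le_add (by linarith) (mul_le_mul_of_nonneg_left ?_ hN)
  nlinarith

end Counts

/-! ### Success probability -/

section Success

variable {n : ℕ} [NeZero n]

/-- `A ≥ (48/5)(HR²/ε) / (8H) = (6/5) R²/ε`, while the energy is at most `R²/2`; the gap is thus at
most `5ε/12`. -/
theorem Inv.sub_lt {f : EuclideanSpace ℝ (Fin n) → ℝ} {l : Fin n → ℝ} {H Z R ε : ℝ}
    {xstar : EuclideanSpace ℝ (Fin n)} {t : Cnt → ℕ} {m : Mem n} (hH : 0 < H) (hR : 0 < R)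
    (hε : 0 < ε) (hεR : ε ≤ H * R ^ 2) (hmin : ∀ x, f xstar ≤ f x)
    (hm : Inv f l H Z R xstar t (outerCount H R ε) m) :
    f (WithLp.toLp 2 (m.arr .v)) - f xstar < ε := by
  set g := f (WithLp.toLp 2 (m.arr .v)) - f xstar with hg
  have hg0 : 0 ≤ g := sub_nonneg.2 (hmin _)
  have h1 : 6 / 5 * (R ^ 2 / ε) ≤ m.sc .A := by
    refine le_trans ?_ hm.le_A
    rw [le_div_iff₀ (by positivity)]
    refine le_trans (le_of_eq ?_) (le_outerCount_sq hε hεR)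
    ring
  have h2 : 6 / 5 * (R ^ 2 / ε) * g ≤ R ^ 2 / 2 := by
    have := hm.energy
    have := mul_le_mul_of_nonneg_right h1 hg0
    have := sq_nonneg ‖WithLp.toLp 2 (m.arr .x) - xstar‖
    linarith
  have h3 : 6 / 5 * (R ^ 2 / ε) * g = R ^ 2 / 2 * (12 / 5 * g / ε) := by
    field_simp
    ring
  rw [h3] at h2
  have h4 : 12 / 5 * g / ε ≤ 1 := by
    have : 0 < R ^ 2 / 2 := by positivity
    exact le_of_mul_le_mul_left (by linarith) this
  rw [div_le_one hε] at h4
  linarith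

open Classical in
-- Setup surely establishes the invariant; each of the `N` outer steps then loses it with
-- probability at most `δ/N`.
theorem wp_method_le {f : EuclideanSpace ℝ (Fin n) → ℝ}
    (τ : EuclideanSpace ℝ (Fin n) → Fin n → ℕ) (hf : Differentiable ℝ f)
    (hconv : ConvexOn ℝ Set.univ f) {l : Fin n → ℝ} (hl : CoordLip f l) {H L δ R : ℝ}
    (hH : 0 < H) (hL : 0 ≤ L) (hlip : ∀ x y, ‖∇ f x - ∇ f y‖ ≤ L * ‖x - y‖)
    {x₀ xstar : EuclideanSpace ℝ (Fin n)} (hmin : ∀ x, f xstar ≤ f x)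
    (hR : ‖x₀ - xstar‖ = R) (hHZ : H < ∑ i, (H + l i)) (hδ : 0 < δ) {N : ℕ} (hN : 0 < N) :
    wp (method.exec (gradOracle f τ) (input H x₀.ofLp l N (innerCount H L l N δ)))
      (fun m => if Inv f l H (∑ i, (H + l i)) R xstar
        (input (n := n) H x₀.ofLp l N (innerCount H L l N δ)).cnt N m then 0 else 1) ≤
      ENNReal.ofReal δ := by
  have hN' : (0 : ℝ) < N := Nat.cast_pos.2 hN
  rw [method, wp_seq]
  refine wp_le_of_sat (sat_setup f _ l H R x₀ xstar hR N _) fun m hm => ?_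
  have h := wp_iter_not_le (outerStep.exec (gradOracle f τ)) _ _
    (wp_outerStep_le τ hf hconv hl hH hL hlip hmin rfl hHZ (div_pos hδ hN')
      (input (n := n) H x₀.ofLp l N (innerCount H L l N δ)).cnt
      (by rw [one_div_div]; exact Nat.le_ceil _)) N 0 m hm
  rw [zero_add, ← ENNReal.ofReal_natCast, ← ENNReal.ofReal_mul hN'.le,
    mul_div_cancel₀ _ hN'.ne'] at h
  have hcnt : m.cnt .outer = N := by rw [hm.cnt_eq]; rfl
  simpa only [Cmd.exec, hcnt] using h

end Success

end CatalystCD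

theorem theorem4 (c : ℝ) (hc : 0 < c) :
    ∃ C : ℝ, 0 < C ∧
    ∀ L Lbar R : ℝ, 0 ≤ L → 0 < Lbar → 0 < R →
    ∃ θ : ℝ, 0 < θ ∧
    ∀ (n : ℕ) [NeZero n] (f : EuclideanSpace ℝ (Fin n) → ℝ) (lip : Fin n → ℝ)
      (x₀ xstar : EuclideanSpace ℝ (Fin n)),
      Differentiable ℝ f →
      ConvexOn ℝ Set.univ f →
      (∀ (i : Fin n) (x : EuclideanSpace ℝ (Fin n)) (u : ℝ),
        |(∇ f (x + u • EuclideanSpace.single i (1 : ℝ))) i - (∇ f x) i| ≤ lip i * |u|) →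
      (∀ x y : EuclideanSpace ℝ (Fin n), ‖∇ f x - ∇ f y‖ ≤ L * ‖x - y‖) →
      Lbar = (∑ i, lip i) / n →
      (∀ x, f xstar ≤ f x) →
      ‖x₀ - xstar‖ = R →
    ∀ (s : ℝ) (τ : EuclideanSpace ℝ (Fin n) → Fin n → ℕ), 1 ≤ s → (∀ y i, (τ y i : ℝ) ≤ c * s) →
    ∀ ε δ : ℝ, 0 < ε → ε ≤ Lbar * R ^ 2 → 0 < δ → δ < 1 → √ε * δ ≤ θ →
      let N := CatalystCD.outerCount Lbar R ε
      let P := CatalystCD.run f τ Lbar x₀ lip N (CatalystCD.innerCount Lbar L lip N δ)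
      (∀ r ∈ P.support, (r.2 : ℝ) ≤
        C * (s * n * √(Lbar * ‖x₀ - xstar‖ ^ 2 / ε) * Real.log (1 / (√ε * δ)))) ∧
      1 - ENNReal.ofReal δ ≤ P.toOuterMeasure {r | f r.1 - f xstar < ε} := by
  -- `100 + 5 (700 + 6c)`: setup, plus at most `5q` outer steps of cost `(700 + 6c) n s ℓ` each.
  refine ⟨3600 + 30 * c, by positivity, fun L Lbar R hL hH hR => ?_⟩
  have hHR : 0 < √(Lbar * R ^ 2) := Real.sqrt_pos.2 (by positivity)
  -- The first bound makes the logarithm at least `1`; the second absorbs the dependence on `L`,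
  -- `Lbar`, `R` into it.
  refine ⟨min (Real.exp (-1))
    (1 / (5 * √(Lbar * R ^ 2) * ((1 + L / Lbar) * (3 + 2 * L / Lbar) ^ 2))),
    lt_min (Real.exp_pos _) (by positivity), ?_⟩
  intro n _ f lip x₀ xstar hf hconv hl hlip hLbar hmin hx₀ s τ hs hτ ε δ hε hεR hδ _ hθ N P
  have hn : (1 : ℝ) ≤ n := Nat.one_le_cast.2 NeZero.one_le
  have hsum : ∑ i, (Lbar + lip i) = 2 * n * Lbar := by
    have : ∑ i, lip i = n * Lbar := by rw [hLbar]; field_simp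
    rw [Finset.sum_add_distrib, this]
    simp
    ring
  have hHZ : Lbar < ∑ i, (Lbar + lip i) := by
    rw [hsum]
    nlinarith
  constructor
  · intro r hr
    rw [hx₀]
    obtain ⟨r', hr', rfl⟩ := (PMF.mem_support_map_iff _ _ _).1 hr
    have hsd : 0 < √ε * δ := mul_pos (Real.sqrt_pos.2 hε) hδ
    have hℓ : 1 ≤ Real.log (1 / (√ε * δ)) := by
      rw [Real.le_log_iff_exp_le (by positivity), le_one_div (Real.exp_pos _) hsd, one_div,
        ← Real.exp_neg]
      exact hθ.trans (min_le_left _ _)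
    have hcost := (CatalystCD.exec_cost_le (CatalystCD.gradOracle f τ) (c * s)
      (fun y i => hτ _ i) _ CatalystCD.method _ rfl r' hr').2
    refine hcost.trans ((CatalystCD.bound_method_le n NeZero.one_le _ _).trans ?_)
    have hM := CatalystCD.innerCount_le hH hL hR hsum hε hεR hδ hℓ (hθ.trans (min_le_right _ _))
    have hN := CatalystCD.outerCount_le hε hεR
    have hq := CatalystCD.sqrt_ratio_ge_one hε hεR
    change 100 * (n : ℝ) + (N : ℝ) * (100 * n + (CatalystCD.innerCount Lbar L lip N δ : ℝ) *
      (c * s + 100) + n * (c * s + 100)) ≤ _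
    change (N : ℝ) ≤ _ at hN
    change (CatalystCD.innerCount Lbar L lip N δ : ℝ) ≤ _ at hM
    have hM0 : (0 : ℝ) ≤ CatalystCD.innerCount Lbar L lip N δ := Nat.cast_nonneg _
    generalize Real.log (1 / (√ε * δ)) = ℓ at *
    generalize √(Lbar * R ^ 2 / ε) = q at *
    generalize (CatalystCD.innerCount Lbar L lip N δ : ℝ) = M at *
    have hsℓ : 1 ≤ s * ℓ := one_le_mul_of_one_le_of_one_le hs hℓ
    have hK : c * s + 100 ≤ (c + 100) * s := by linarith
    have hnℓ : (n : ℝ) ≤ n * ℓ := le_mul_of_one_le_right (by positivity) hℓ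
    have h1 : 100 * (n : ℝ) + M * (c * s + 100) + n * (c * s + 100) ≤
        (700 + 6 * c) * (n * (s * ℓ)) := by
      calc _ ≤ 100 * (n * (s * ℓ)) + 5 * n * ℓ * ((c + 100) * s) + n * ℓ * ((c + 100) * s) := by
            gcongr
            exact le_mul_of_one_le_right (by positivity) hsℓ
        _ = _ := by ring
    calc _ ≤ 100 * (n * (s * ℓ) * q) + 5 * q * ((700 + 6 * c) * (n * (s * ℓ))) := by
          gcongr
          rw [mul_assoc]
          exact le_mul_of_one_le_right (by positivity) (one_le_mul_of_one_le_of_one_le hsℓ hq)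
      _ = _ := by ring
  · classical
    have hNpos : 0 < N := CatalystCD.outerCount_pos hε hεR
    change _ ≤ (PMF.map _ _).toOuterMeasure _
    rw [PMF.toOuterMeasure_map_apply]
    exact CatalystCD.one_sub_le_toOuterMeasure _ _ _
      (fun r hr => CatalystCD.Inv.sub_lt hH hR hε hεR hmin hr)
      (CatalystCD.wp_method_le τ hf hconv hl hH hL hlip hmin hx₀ hHZ hδ hNpos)
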